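/- Let $A:\mathfrak D(A)\subset H\to H$ be a strictly positive self-adjoint operator with compact inverse on a complex Hilbert space $H$; let $a,\alpha,\beta,\eta$ be real constants with $a\neq 0$ and $0<\alpha<\beta$, and let $\phi\in[0,1]$. Consider the abstract MGT--Fourier system $$\alpha u_{ttt}+u_{tt}+a^2Au+a^2\beta Au_t-\eta A^\phi\theta=0,\qquad \theta_t+A\theta+\alpha\eta A^\phi u_{tt}+\eta A^\phi u_t=0,$$ on the phase space $\mathbb H=\mathfrak D(A^{1/2})\times\mathfrak D(A^{1/2})\times H\times H$ of states $U=(u,v,w,\theta)$ (with $v=u_t$, $w=u_{tt}$), normed by $$\|U\|_{\mathbb H}^2=a^2\alpha(\beta-\alpha)\|A^{1/2}v\|^2+a^2\|A^{1/2}u+\alpha A^{1/2}v\|^2+\|v+\alpha w\|^2+\|\theta\|^2 .$$ Let $\mathbb B$ be the operator on $\mathbb H$ with domain $$\mathfrak D(\mathbb B)=\{U\in\mathbb H:\ w\in\mathfrak D(A^{1/2}),\ a^2u+a^2\beta v-\eta A^{\phi-1}\theta\in\mathfrak D(A),\ \eta A^{\phi-1}v+\alpha\eta A^{\phi-1}w+\theta\in\mathfrak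 D(A)\}$$ and $$\mathbb BU=\Big(v,\ w,\ -\tfrac1\alpha\big[A(a^2u+a^2\beta v-\eta A^{\phi-1}\theta)+w\big],\ -A\big(\eta A^{\phi-1}v+\alpha\eta A^{\phi-1}w+\theta\big)\Big).$$ Then $\mathbb B$ generates a $C_0$-semigroup $S(t)=e^{t\mathbb B}$ on $\mathbb H$, and this semigroup is exponentially stable: there are constants $M,\omega>0$ such that $\|S(t)\|_{\mathcal L(\mathbb H)}\le Me^{-\omega t}$ for all $t\ge 0$. -/

import Mathlib

open Filter Topology

noncomputable section

/-! ### Strongly continuous semigroups -/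

section Semigroups

variable {E : Type*} [NormedAddCommGroup E] [NormedSpace ℂ E]

/-- `S` is a strongly continuous one-parameter semigroup (`C₀`-semigroup) of bounded linear
operators on `E`. Only the values `S t` for `t ≥ 0` matter. -/
structure IsC0Semigroup (S : ℝ → E →L[ℂ] E) : Prop where
  map_zero : S 0 = ContinuousLinearMap.id ℂ E
  map_add : ∀ s t : ℝ, 0 ≤ s → 0 ≤ t → S (s + t) = (S s).comp (S t)
  tendsto_zero : ∀ x : E, Tendsto (fun t : ℝ => S t x) (𝓝[>] 0) (𝓝 x)

/-- The (possibly unbounded) operator `B` is the infinitesimal generator of `S`: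
`x ∈ D(B)` with `B x = y` if and only if `(S t x - x) / t → y` as `t → 0⁺`. -/
def IsGenerator (B : E →ₗ.[ℂ] E) (S : ℝ → E →L[ℂ] E) : Prop :=
  ∀ x y : E, (x, y) ∈ B.graph ↔
    Tendsto (fun t : ℝ => ((t : ℂ)⁻¹) • (S t x - x)) (𝓝[>] 0) (𝓝 y)

/-- `S` is exponentially stable: `‖S t‖ ≤ M e^{-ω t}` for all `t ≥ 0`, with some `M, ω > 0`. -/
def ExponentiallyStable (S : ℝ → E →L[ℂ] E) : Prop :=
  ∃ M ω : ℝ, 0 < M ∧ 0 < ω ∧ ∀ t : ℝ, 0 ≤ t → ‖S t‖ ≤ M * Real.exp (-ω * t)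

end Semigroups

/-! ### Strictly positive operators with compact inverse and their fractional powers -/

/-- The data of a strictly positive self-adjoint operator `A` with compact inverse on a complex
Hilbert space `H`. -/
structure StrictlyPositiveOperator (H : Type*) [NormedAddCommGroup H] [InnerProductSpace ℂ H]
    [CompleteSpace H] where
  /-- the operator, with its domain -/
  A : H →ₗ.[ℂ] H
  selfAdjoint : IsSelfAdjoint A
  pos : ∀ x : A.domain, x ≠ 0 → 0 < (inner ℂ (A x) (x : H)).re
  compactInverse : ∃ G : H →L[ℂ] H, IsCompactOperator G ∧
    (∀ x : A.domain, G (A x) = x) ∧ (∀ y : H, ∃ h : G y ∈ A.domain, A ⟨G y, h⟩ = y)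

namespace StrictlyPositiveOperator

variable {H : Type*} [NormedAddCommGroup H] [InnerProductSpace ℂ H] [CompleteSpace H]
variable (P : StrictlyPositiveOperator H)

/-- The bounded inverse `A⁻¹`. -/
def inv : H →L[ℂ] H := P.compactInverse.choose

theorem inv_apply_A (x : P.A.domain) : P.inv (P.A x) = x :=
  P.compactInverse.choose_spec.2.1 x

theorem inv_mem_domain (y : H) : P.inv y ∈ P.A.domain :=
  (P.compactInverse.choose_spec.2.2 y).choose

theorem A_inv_apply (y : H) : P.A ⟨P.inv y, P.inv_mem_domain y⟩ = y :=
  (P.compactInverse.choose_spec.2.2 y).choose_spec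

/-- The bounded operator `A^{-s} = (A⁻¹)^s` for `s ≥ 0`, by the continuous functional calculus of
the bounded positive operator `A⁻¹`. -/
def negPow (s : ℝ) : H →L[ℂ] H := P.inv ^ s

/-- The operator `A^s = (A^{-s})⁻¹` for `s ≥ 0`, with domain `D(A^s)` the range of `A^{-s}`. -/
def fracPow (s : ℝ) : H →ₗ.[ℂ] H :=
  ((P.negPow s : H →ₗ[ℂ] H).toPMap ⊤).inverse

/-- The space `D(A^{1/2})`. -/
abbrev DHalf : Submodule ℂ H := (P.fracPow (1 / 2)).domain

/-- The operator `A^{1/2}` on its domain. -/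
def AHalf : P.DHalf →ₗ[ℂ] H := (P.fracPow (1 / 2)).toFun

theorem A_isFormalAdjoint (x y : P.A.domain) :
    inner ℂ (P.A x) (y : H) = inner ℂ (x : H) (P.A y) := by
  have h := LinearPMap.adjoint_isFormalAdjoint P.selfAdjoint.dense_domain
  rw [LinearPMap.isSelfAdjoint_def.mp P.selfAdjoint] at h
  exact h x y

theorem inv_isPositive : P.inv.IsPositive := by
  rw [ContinuousLinearMap.isPositive_iff]
  have key : ∀ x y : H, inner ℂ (P.inv x) y = inner ℂ x (P.inv y) := by
    intro x y
    have h := P.A_isFormalAdjoint ⟨P.inv x, P.inv_mem_domain x⟩ ⟨P.inv y, P.inv_mem_domain y⟩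
    rw [P.A_inv_apply, P.A_inv_apply] at h
    exact h.symm
  refine ⟨key, fun x => ?_⟩
  have hre : 0 ≤ (inner ℂ (P.inv x) x).re := by
    have h := P.pos ⟨P.inv x, P.inv_mem_domain x⟩
    rw [P.A_inv_apply] at h
    by_cases h0 : P.inv x = 0
    · simp [h0]
    · have := h (fun hc => h0 (congrArg Subtype.val hc))
      rw [key]
      exact this.le
  have him : (inner ℂ (P.inv x) x).im = 0 := by
    have h1 := inner_conj_symm (𝕜 := ℂ) x (P.inv x)
    rw [key] at h1
    rw [key]
    exact Complex.conj_eq_iff_im.mp (by rw [h1])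
  exact Complex.nonneg_iff.mpr ⟨hre, him.symm⟩

theorem inv_nonneg : 0 ≤ P.inv :=
  (ContinuousLinearMap.nonneg_iff_isPositive _).mpr P.inv_isPositive

theorem negPow_half_injective : Function.Injective (P.negPow (1 / 2)) := by
  have hsq : P.negPow (1 / 2) * P.negPow (1 / 2) = P.inv := by
    have h := CFC.sqrt_mul_sqrt_self P.inv P.inv_nonneg
    rwa [CFC.sqrt_eq_rpow] at h
  intro x y hxy
  have h2 : P.inv x = P.inv y := by
    rw [← hsq, mul_apply_eq_comp, mul_apply_eq_comp, hxy]
  rw [← P.A_inv_apply x, ← P.A_inv_apply y]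
  congr 1
  exact Subtype.ext h2

theorem negPow_AHalf (x : P.DHalf) : P.negPow (1 / 2) (P.AHalf x) = x := by
  have hker : ((P.negPow (1 / 2) : H →ₗ[ℂ] H).toPMap ⊤).toFun.ker = ⊥ := by
    rw [LinearMap.ker_eq_bot]
    intro x y hxy
    exact Subtype.ext (P.negPow_half_injective hxy)
  have hx : (x : H) ∈ ((P.negPow (1 / 2) : H →ₗ[ℂ] H).toPMap ⊤).inverse.domain := x.2
  rw [LinearPMap.inverse_domain] at hx
  obtain ⟨z, hz⟩ := hx
  have h := LinearPMap.inverse_apply_eq hker (y := x) (x := z) hz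
  have h' : P.AHalf x = z := h
  rw [h']
  exact hz

theorem AHalf_eq_zero {x : P.DHalf} (h : P.AHalf x = 0) : x = 0 := by
  have h1 := P.negPow_AHalf x
  rw [h, map_zero] at h1
  exact Subtype.ext h1.symm

end StrictlyPositiveOperator

/-! ### The MGT-Fourier system -/

/-- The operator `A` and the physical constants of the MGT-Fourier system
`α u_ttt + u_tt + a² A u + a² β A u_t - η A^φ θ = 0`,
`θ_t + A θ + α η A^φ u_tt + η A^φ u_t = 0`, in the regime `0 < α < β`. -/
structure MGTFourier (H : Type*) [NormedAddCommGroup H] [InnerProductSpace ℂ H]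
    [CompleteSpace H] extends StrictlyPositiveOperator H where
  a : ℝ
  α : ℝ
  β : ℝ
  η : ℝ
  a_ne_zero : a ≠ 0
  α_pos : 0 < α
  α_lt_β : α < β

namespace MGTFourier

variable {H : Type*} [NormedAddCommGroup H] [InnerProductSpace ℂ H] [CompleteSpace H]

/-- The phase space `D(A^{1/2}) × D(A^{1/2}) × H × H` of states `U = (u, v, w, θ)`. -/
def PhaseSpace (P : MGTFourier H) : Type _ := P.DHalf × P.DHalf × H × H

variable (P : MGTFourier H)

instance : AddCommGroup P.PhaseSpace :=
  inferInstanceAs (AddCommGroup (P.DHalf × P.DHalf × H × H))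

instance : Module ℂ P.PhaseSpace :=
  inferInstanceAs (Module ℂ (P.DHalf × P.DHalf × H × H))

/-- The first component `u`. -/
def u : P.PhaseSpace →ₗ[ℂ] P.DHalf := LinearMap.fst ℂ P.DHalf (P.DHalf × H × H)

/-- The second component `v`. -/
def v : P.PhaseSpace →ₗ[ℂ] P.DHalf :=
  (LinearMap.fst ℂ P.DHalf (H × H)).comp (LinearMap.snd ℂ P.DHalf (P.DHalf × H × H))

/-- The third component `w`. -/
def w : P.PhaseSpace →ₗ[ℂ] H :=
  (LinearMap.fst ℂ H H).comp
    ((LinearMap.snd ℂ P.DHalf (H × H)).comp (LinearMap.snd ℂ P.DHalf (P.DHalf × H × H)))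

/-- The fourth component `θ`. -/
def θ : P.PhaseSpace →ₗ[ℂ] H :=
  (LinearMap.snd ℂ H H).comp
    ((LinearMap.snd ℂ P.DHalf (H × H)).comp (LinearMap.snd ℂ P.DHalf (P.DHalf × H × H)))

/-- The state with the given components. -/
def state (u v : P.DHalf) (w θ : H) : P.PhaseSpace := (u, v, w, θ)

theorem ext_components {U V : P.PhaseSpace} (hu : P.u U = P.u V) (hv : P.v U = P.v V)
    (hw : P.w U = P.w V) (ht : P.θ U = P.θ V) : U = V :=
  Prod.ext hu (Prod.ext hv (Prod.ext hw ht))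

/-- The energy inner product
`a² α (β - α) ⟨A^{1/2} v₁, A^{1/2} v₂⟩ + a² ⟨A^{1/2} u₁ + α A^{1/2} v₁, A^{1/2} u₂ + α A^{1/2} v₂⟩
+ ⟨v₁ + α w₁, v₂ + α w₂⟩ + ⟨θ₁, θ₂⟩`. -/
def energyInner (U V : P.PhaseSpace) : ℂ :=
  ((P.a ^ 2 * P.α * (P.β - P.α) : ℝ) : ℂ) * inner ℂ (P.AHalf (P.v U)) (P.AHalf (P.v V))
  + ((P.a ^ 2 : ℝ) : ℂ) * inner ℂ (P.AHalf (P.u U) + (P.α : ℂ) • P.AHalf (P.v U))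
      (P.AHalf (P.u V) + (P.α : ℂ) • P.AHalf (P.v V))
  + inner ℂ ((P.v U : H) + (P.α : ℂ) • P.w U) ((P.v V : H) + (P.α : ℂ) • P.w V)
  + inner ℂ (P.θ U) (P.θ V)

theorem energyInner_self_re (U : P.PhaseSpace) :
    (P.energyInner U U).re = P.a ^ 2 * P.α * (P.β - P.α) * ‖P.AHalf (P.v U)‖ ^ 2
      + P.a ^ 2 * ‖P.AHalf (P.u U) + (P.α : ℂ) • P.AHalf (P.v U)‖ ^ 2
      + ‖(P.v U : H) + (P.α : ℂ) • P.w U‖ ^ 2 + ‖P.θ U‖ ^ 2 := by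
  have h : ∀ x : H, (inner ℂ x x : ℂ).re = ‖x‖ ^ 2 := fun x => inner_self_eq_norm_sq (𝕜 := ℂ) x
  simp only [energyInner, Complex.add_re, Complex.re_ofReal_mul, h]

/-- The energy inner product is an inner product. -/
@[reducible] def core : InnerProductSpace.Core ℂ P.PhaseSpace where
  inner := P.energyInner
  conj_inner_symm U V := by
    simp only [energyInner, map_add, map_mul, Complex.conj_ofReal, inner_conj_symm]
  re_inner_nonneg U := by
    change 0 ≤ (P.energyInner U U).re
    have h1 := sub_pos.mpr P.α_lt_β
    have h2 := P.α_pos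
    rw [energyInner_self_re]
    positivity
  add_left U V W := by
    simp only [energyInner, map_add, Submodule.coe_add, smul_add, inner_add_left]
    ring
  smul_left U V r := by
    simp only [energyInner, map_smul, Submodule.coe_smul, smul_comm _ r, ← smul_add,
      inner_smul_left]
    ring
  definite U hU := by
    have h1 := sub_pos.mpr P.α_lt_β
    have h2 := P.α_pos
    have h3 : 0 < P.a ^ 2 := by have := P.a_ne_zero; positivity
    have h : (P.energyInner U U).re = 0 := by
      change P.energyInner U U = 0 at hU
      rw [hU]; rfl
    rw [energyInner_self_re] at h
    have p1 : 0 ≤ P.a ^ 2 * P.α * (P.β - P.α) * ‖P.AHalf (P.v U)‖ ^ 2 := by positivity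
    have p2 : 0 ≤ P.a ^ 2 * ‖P.AHalf (P.u U) + (P.α : ℂ) • P.AHalf (P.v U)‖ ^ 2 := by positivity
    have p3 : 0 ≤ ‖(P.v U : H) + (P.α : ℂ) • P.w U‖ ^ 2 := by positivity
    have p4 : 0 ≤ ‖P.θ U‖ ^ 2 := by positivity
    have c1 : P.a ^ 2 * P.α * (P.β - P.α) ≠ 0 := by positivity
    have q1 : P.a ^ 2 * P.α * (P.β - P.α) * ‖P.AHalf (P.v U)‖ ^ 2 = 0 := by linarith
    have q2 : P.a ^ 2 * ‖P.AHalf (P.u U) + (P.α : ℂ) • P.AHalf (P.v U)‖ ^ 2 = 0 := by linarith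
    have q3 : ‖(P.v U : H) + (P.α : ℂ) • P.w U‖ ^ 2 = 0 := by linarith
    have q4 : ‖P.θ U‖ ^ 2 = 0 := by linarith
    have hv : P.v U = 0 := P.AHalf_eq_zero (by simpa [c1] using q1)
    have hu : P.u U = 0 := P.AHalf_eq_zero (by simpa [hv, h3.ne', P.a_ne_zero] using q2)
    have hw : P.w U = 0 := by simpa [hv, h2.ne'] using q3
    have ht : P.θ U = 0 := by simpa using q4
    apply P.ext_components <;> simp [hu, hv, hw, ht]

/-- The phase space carries the norm of the energy inner product. -/
instance : NormedAddCommGroup P.PhaseSpace := P.core.toNormedAddCommGroup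

instance : InnerProductSpace ℂ P.PhaseSpace := InnerProductSpace.ofCore P.core.toCore

/-- The element `a² u + a² β v - η A^{φ-1} θ` of `H`. -/
def stress (φ : ℝ) : P.PhaseSpace →ₗ[ℂ] H :=
  ((P.a ^ 2 : ℝ) : ℂ) • P.DHalf.subtype.comp P.u
    + ((P.a ^ 2 * P.β : ℝ) : ℂ) • P.DHalf.subtype.comp P.v
    - (P.η : ℂ) • (P.negPow (1 - φ) : H →ₗ[ℂ] H).comp P.θ

/-- The element `η A^{φ-1} v + α η A^{φ-1} w + θ` of `H`. -/
def flux (φ : ℝ) : P.PhaseSpace →ₗ[ℂ] H :=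
  (P.η : ℂ) • (P.negPow (1 - φ) : H →ₗ[ℂ] H).comp (P.DHalf.subtype.comp P.v)
    + ((P.α * P.η : ℝ) : ℂ) • (P.negPow (1 - φ) : H →ₗ[ℂ] H).comp P.w
    + P.θ

/-- The domain of the evolution operator: all `U = (u, v, w, θ)` in the phase space with
`w ∈ D(A^{1/2})`, `a² u + a² β v - η A^{φ-1} θ ∈ D(A)` and
`η A^{φ-1} v + α η A^{φ-1} w + θ ∈ D(A)`. -/
def evolutionDomain (φ : ℝ) : Submodule ℂ P.PhaseSpace :=
  P.DHalf.comap P.w ⊓ P.A.domain.comap (P.stress φ) ⊓ P.A.domain.comap (P.flux φ)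

/-- The evolution operator
`B U = (v, w, -(1/α) [A (a² u + a² β v - η A^{φ-1} θ) + w], -A (η A^{φ-1} v + α η A^{φ-1} w + θ))`
for `0 ≤ φ ≤ 1`. -/
def evolution (φ : ℝ) : P.PhaseSpace →ₗ.[ℂ] P.PhaseSpace where
  domain := P.evolutionDomain φ
  toFun :=
    { toFun := fun U => P.state (P.v U.1) ⟨P.w U.1, U.2.1.1⟩
        (-(P.α : ℂ)⁻¹ • (P.A ⟨P.stress φ U.1, U.2.1.2⟩ + P.w U.1))
        (-P.A ⟨P.flux φ U.1, U.2.2⟩)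
      map_add' := by
        intro U V
        have h1 : (⟨P.stress φ (U + V).1, (U + V).2.1.2⟩ : P.A.domain)
            = ⟨P.stress φ U.1, U.2.1.2⟩ + ⟨P.stress φ V.1, V.2.1.2⟩ :=
          Subtype.ext (map_add (P.stress φ) U.1 V.1)
        have h2 : (⟨P.flux φ (U + V).1, (U + V).2.2⟩ : P.A.domain)
            = ⟨P.flux φ U.1, U.2.2⟩ + ⟨P.flux φ V.1, V.2.2⟩ :=
          Subtype.ext (map_add (P.flux φ) U.1 V.1)
        rw [h1, h2, LinearPMap.map_add, LinearPMap.map_add]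
        refine P.ext_components (map_add P.v U.1 V.1) (Subtype.ext (map_add P.w U.1 V.1)) ?_ ?_
        · change -(P.α : ℂ)⁻¹ • (_ + P.w (U.1 + V.1)) = -(P.α : ℂ)⁻¹ • _ + -(P.α : ℂ)⁻¹ • _
          rw [map_add, ← smul_add]
          congr 1
          abel
        · exact neg_add _ _
      map_smul' := by
        intro r U
        have h1 : (⟨P.stress φ (r • U).1, (r • U).2.1.2⟩ : P.A.domain)
            = r • ⟨P.stress φ U.1, U.2.1.2⟩ :=
          Subtype.ext (map_smul (P.stress φ) r U.1)
        have h2 : (⟨P.flux φ (r • U).1, (r • U).2.2⟩ : P.A.domain)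
            = r • ⟨P.flux φ U.1, U.2.2⟩ :=
          Subtype.ext (map_smul (P.flux φ) r U.1)
        rw [h1, h2, LinearPMap.map_smul, LinearPMap.map_smul]
        refine P.ext_components (map_smul P.v r U.1) (Subtype.ext (map_smul P.w r U.1)) ?_ ?_
        · change -(P.α : ℂ)⁻¹ • (_ + P.w (r • U.1)) = r • (-(P.α : ℂ)⁻¹ • _)
          rw [map_smul, ← smul_add, smul_comm]
        · exact (smul_neg _ _).symm }

end MGTFourier

end

/-!
The evolution operator `B` is the inverse of an explicit bounded operator `G`
(`MGTFourier.evolutionInverse`, `MGTFourier.mem_evolution_graph_iff`), so both claims are reduced to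
statements about `G`.

*Generation.* Testing the equations with `v + α w` and `θ` gives the energy identity
`Re ⟨B U, U⟩ = -a² (β - α) ‖A^{1/2} v‖² - ‖A^{1/2} θ‖²`
(`MGTFourier.re_inner_evolutionInverse`), so `G` is an injective bounded dissipative operator on a
Hilbert space. Such a `G` has dense range, its Yosida approximations `(G - ε)⁻¹` are bounded
commuting dissipative operators, and their exponentials converge strongly as `ε → 0` to a contraction
semigroup with generator `G⁻¹` (`IsDissipative.exists_isC0Semigroup`).

*Stability.* The dissipation misses `v + α w` and `A^{1/2} u`. Both are recovered from the bounded
form `Re ⟨v + α w, u - α v⟩`, whose derivative along solutions is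
`-a² ‖A^{1/2} (u - α v)‖² - ‖v + α w‖²` up to terms absorbed by the dissipation and by small
multiples of these two (`MGTFourier.cross_term_identity`, `MGTFourier.exists_cross_term_le`). The
coupling enters only through `A^{φ-1}` applied to `A^{1/2} θ`, which is a bounded operator. Adding a
large multiple of the energy gives a functional equivalent to the squared norm which decays at a rate
proportional to itself on the domain of `B`, hence on the whole space by density
(`exponentiallyStable_of_cross_term`). This argument applies to any `C₀`-semigroup generated by `B`.
-/

section StrongLimits

variable {E : Type*} [NormedAddCommGroup E]

/-! ### Strong limits of equibounded operators -/

theorem tendsto_apply_of_dense {ι : Type*} {l : Filter ι} {T : ι → E → E}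
    {T₀ : E → E} {K : ℝ} (hT : ∀ᶠ i in l, ∀ x y, ‖T i x - T i y‖ ≤ K * ‖x - y‖)
    (hT₀ : ∀ x y, ‖T₀ x - T₀ y‖ ≤ K * ‖x - y‖) {s : Set E} (hs : Dense s)
    (h : ∀ x ∈ s, Tendsto (fun i => T i x) l (𝓝 (T₀ x))) (x : E) :
    Tendsto (fun i => T i x) l (𝓝 (T₀ x)) := by
  rw [Metric.tendsto_nhds]
  intro ε hε
  have hK : 0 < |K| + 1 := by positivity
  obtain ⟨y, hy, hxy⟩ := hs.exists_dist_lt x (ε := ε / 3 / (|K| + 1)) (by positivity)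
  have hKxy : K * ‖x - y‖ < ε / 3 := by
    rw [dist_eq_norm, lt_div_iff₀ hK] at hxy
    nlinarith [le_abs_self K, norm_nonneg (x - y)]
  filter_upwards [hT, Metric.tendsto_nhds.1 (h y hy) (ε / 3) (by positivity)] with i hi hy
  have h3 := dist_triangle4 (T i x) (T i y) (T₀ y) (T₀ x)
  have h1 := hi x y
  have h2 := hT₀ x y
  rw [← dist_eq_norm] at h1 h2
  rw [dist_comm (T₀ x)] at h2
  linarith

variable [NormedSpace ℂ E]

theorem cauchySeq_apply_of_dense {T : ℕ → E →L[ℂ] E} (hT : ∀ n x, ‖T n x‖ ≤ ‖x‖) {s : Set E}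
    (hs : Dense s) (h : ∀ x ∈ s, CauchySeq fun n => T n x) (x : E) : CauchySeq fun n => T n x := by
  rw [Metric.cauchySeq_iff']
  intro ε hε
  obtain ⟨y, hy, hxy⟩ := hs.exists_dist_lt x (ε := ε / 3) (by positivity)
  obtain ⟨N, hN⟩ := Metric.cauchySeq_iff'.1 (h y hy) (ε / 3) (by positivity)
  refine ⟨N, fun n hn => ?_⟩
  have h1 : ∀ k, dist (T k x) (T k y) < ε / 3 := fun k => by
    rw [dist_eq_norm, ← map_sub]
    exact (hT k _).trans_lt (by rwa [← dist_eq_norm])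
  have h2 := hN n hn
  have h3 := dist_triangle4 (T n x) (T n y) (T N y) (T N x)
  have h4 := h1 N
  rw [dist_comm] at h4
  linarith [h1 n]

end StrongLimits

section Inequalities

/-! ### Inequalities for norms and inner products -/

variable {E : Type*} [NormedAddCommGroup E]

theorem norm_sub_sq_le (x y : E) : ‖x - y‖ ^ 2 ≤ 2 * (‖x‖ ^ 2 + ‖y‖ ^ 2) := by
  have h := pow_le_pow_left₀ (norm_nonneg _) (norm_sub_le x y) 2
  nlinarith [sq_nonneg (‖x‖ - ‖y‖)]

variable [InnerProductSpace ℂ E]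

theorem norm_sq_eq_re_inner_self (x : E) : ‖x‖ ^ 2 = (inner ℂ x x : ℂ).re :=
  norm_sq_eq_re_inner (𝕜 := ℂ) x

theorem re_inner_comm (x y : E) : (inner ℂ x y : ℂ).re = (inner ℂ y x : ℂ).re :=
  inner_re_symm (𝕜 := ℂ) x y

theorem re_inner_le_norm_mul (x y : E) : (inner ℂ x y : ℂ).re ≤ ‖x‖ * ‖y‖ :=
  (Complex.re_le_norm _).trans (norm_inner_le_norm x y)

theorem neg_norm_mul_le_re_inner (x y : E) : -(‖x‖ * ‖y‖) ≤ (inner ℂ x y : ℂ).re :=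
  (neg_le_neg (norm_inner_le_norm x y)).trans (neg_le_of_abs_le (Complex.abs_re_le_norm _))

theorem re_inner_le_young (x y : E) {m : ℝ} (hm : 0 < m) :
    (inner ℂ x y : ℂ).re ≤ m / 2 * ‖y‖ ^ 2 + ‖x‖ ^ 2 / (2 * m) := by
  refine (re_inner_le_norm_mul x y).trans ?_
  have e : m / 2 * ‖y‖ ^ 2 + ‖x‖ ^ 2 / (2 * m) - ‖x‖ * ‖y‖ = (m * ‖y‖ - ‖x‖) ^ 2 / (2 * m) := by
    field_simp
    ring
  have : 0 ≤ (m * ‖y‖ - ‖x‖) ^ 2 / (2 * m) := by positivity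
  linarith

theorem hasDerivWithinAt_re_inner_apply (Q : E →L[ℂ] E) {f : ℝ → E} {f' : E} {s : Set ℝ} {t : ℝ}
    (hf : HasDerivWithinAt f f' s t) :
    HasDerivWithinAt (fun r => (inner ℂ (Q (f r)) (f r) : ℂ).re)
      ((inner ℂ (Q (f t)) f' : ℂ).re + (inner ℂ (Q f') (f t) : ℂ).re) s t := by
  have hQ : HasDerivWithinAt (fun r => Q (f r)) (Q f') s t :=
    ((Q.restrictScalars ℝ).hasFDerivAt.comp_hasDerivWithinAt t hf)
  have h := Complex.reCLM.hasFDerivAt.comp_hasDerivWithinAt t (HasDerivWithinAt.inner ℂ hQ hf)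
  simpa using! h

end Inequalities

section HilbertSemigroups

variable {E : Type*} [NormedAddCommGroup E] [InnerProductSpace ℂ E]

/-! ### Bounded dissipative operators -/

/-- A bounded operator `C` is dissipative if `Re ⟨C x, x⟩ ≤ 0` for all `x`. -/
def IsDissipative (C : E →L[ℂ] E) : Prop := ∀ x, (inner ℂ (C x) x : ℂ).re ≤ 0

/-- The uniformly continuous semigroup `e^{tC}` of a bounded operator `C`. -/
noncomputable def expSemigroup (C : E →L[ℂ] E) (t : ℝ) : E →L[ℂ] E :=
  NormedSpace.exp ((t : ℂ) • C)

@[simp] theorem expSemigroup_zero (C : E →L[ℂ] E) : expSemigroup C 0 = 1 := by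
  simp [expSemigroup]

/-- The Yosida approximation `(G - ε)⁻¹ = B (1 - ε B)⁻¹` of the operator `B = G⁻¹`. -/
noncomputable def yosida (G : E →L[ℂ] E) (ε : ℝ) : E →L[ℂ] E :=
  Ring.inverse (G - (ε : ℂ) • (1 : E →L[ℂ] E))

theorem commute_yosida_yosida (G : E →L[ℂ] E) (ε δ : ℝ) : Commute (yosida G ε) (yosida G δ) :=
  Commute.ringInverse_ringInverse
    (((Commute.refl G).sub_right ((Commute.one_right G).smul_right _)).sub_left
      (((Commute.one_left _)).smul_left _))

variable [CompleteSpace E]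

theorem expSemigroup_add (C : E →L[ℂ] E) (s t : ℝ) :
    expSemigroup C (s + t) = expSemigroup C s * expSemigroup C t := by
  rw [expSemigroup, expSemigroup, expSemigroup, Complex.ofReal_add, add_smul]
  have : NormedAlgebra ℚ (E →L[ℂ] E) := .restrictScalars ℚ ℂ (E →L[ℂ] E)
  exact NormedSpace.exp_add_of_commute (((Commute.refl C).smul_left _).smul_right _)

theorem Commute.expSemigroup_right {C D : E →L[ℂ] E} (h : Commute D C) (t : ℝ) :
    Commute D (expSemigroup C t) :=
  (h.smul_right _).exp_right

theorem hasDerivAt_expSemigroup (C : E →L[ℂ] E) (t : ℝ) :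
    HasDerivAt (expSemigroup C) (expSemigroup C t * C) t :=
  by simpa using! (hasDerivAt_exp_smul_const C (t : ℂ)).scomp t Complex.ofRealCLM.hasDerivAt

theorem hasDerivAt_expSemigroup_apply (C : E →L[ℂ] E) (x : E) (t : ℝ) :
    HasDerivAt (fun s => expSemigroup C s x) (expSemigroup C t (C x)) t := by
  have h := (((ContinuousLinearMap.apply ℂ E x).restrictScalars ℝ).hasFDerivAt).comp_hasDerivAt t
    (hasDerivAt_expSemigroup C t)
  simpa using! h

theorem IsDissipative.norm_expSemigroup_apply_le {C : E →L[ℂ] E} (hC : IsDissipative C) {t : ℝ}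
    (ht : 0 ≤ t) (x : E) : ‖expSemigroup C t x‖ ≤ ‖x‖ := by
  have hder : ∀ s, HasDerivAt (fun r => (inner ℂ (expSemigroup C r x) (expSemigroup C r x) : ℂ).re)
      (2 * (inner ℂ (C (expSemigroup C s x)) (expSemigroup C s x) : ℂ).re) s := by
    intro s
    have h := (hasDerivAt_expSemigroup_apply C x s).hasDerivWithinAt (s := Set.univ)
    have h2 := hasDerivWithinAt_re_inner_apply 1 h
    rw [hasDerivWithinAt_univ] at h2
    have hc : expSemigroup C s (C x) = C (expSemigroup C s x) :=
      (DFunLike.congr_fun ((Commute.refl C).expSemigroup_right s) x).symm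
    convert! h2 using 1
    simp only [one_apply_eq_self, hc]
    rw [re_inner_comm (expSemigroup C s x)]
    ring
  have hanti := antitone_of_hasDerivAt_nonpos hder
    (fun s => mul_nonpos_of_nonneg_of_nonpos two_pos.le (hC (expSemigroup C s x)))
  have h0 := hanti ht
  simp only [expSemigroup_zero, one_apply_eq_self, ← norm_sq_eq_re_inner_self] at h0
  exact le_of_sq_le_sq h0 (norm_nonneg _)

theorem IsDissipative.norm_expSemigroup_sub_le {C : E →L[ℂ] E} (hC : IsDissipative C) {t : ℝ}
    (ht : 0 ≤ t) (x : E) : ‖expSemigroup C t x - x‖ ≤ t * ‖C x‖ := by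
  have h := norm_image_sub_le_of_norm_deriv_le_segment' (a := 0) (b := t) (C := ‖C x‖)
    (fun s _ => (hasDerivAt_expSemigroup_apply C x s).hasDerivWithinAt)
    (fun s hs => hC.norm_expSemigroup_apply_le hs.1 _) t ⟨ht, le_rfl⟩
  simpa [mul_comm] using h

theorem IsDissipative.norm_expSemigroup_sub_sub_le {C : E →L[ℂ] E} (hC : IsDissipative C) {t : ℝ}
    (ht : 0 ≤ t) (x : E) : ‖expSemigroup C t x - x - t • C x‖ ≤ t ^ 2 * ‖C (C x)‖ := by
  have h := norm_image_sub_le_of_norm_deriv_le_segment' (a := 0) (b := t) (C := t * ‖C (C x)‖)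
    (f := fun s : ℝ => expSemigroup C s x - s • C x)
    (fun s _ => ((hasDerivAt_expSemigroup_apply C x s).sub
      ((hasDerivAt_id s).smul_const (C x))).hasDerivWithinAt)
    (fun s hs => by
      simp only [one_smul]
      exact (hC.norm_expSemigroup_sub_le hs.1 _).trans (by gcongr; exact hs.2.le))
    t ⟨ht, le_rfl⟩
  simp only [expSemigroup_zero, one_apply_eq_self, zero_smul, sub_zero] at h
  rw [sub_right_comm]
  exact h.trans_eq (by ring)

theorem IsDissipative.norm_expSemigroup_sub_expSemigroup_le {C D : E →L[ℂ] E}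
    (hC : IsDissipative C) (hD : IsDissipative D) (hCD : Commute C D) {t : ℝ} (ht : 0 ≤ t)
    (x : E) : ‖expSemigroup C t x - expSemigroup D t x‖ ≤ t * ‖C x - D x‖ := by
  -- interpolate by `s ↦ e^{sC} e^{(t-s)D} x`
  have hder : ∀ s, HasDerivAt (fun s => expSemigroup C s * expSemigroup D (t - s))
      (expSemigroup C s * expSemigroup D (t - s) * (C - D)) s := by
    intro s
    have h1 := (hasDerivAt_expSemigroup D (t - s)).scomp s ((hasDerivAt_id s).const_sub t)
    have h2 := (hasDerivAt_expSemigroup C s).mul h1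
    convert! h2 using 1
    have hc : C * expSemigroup D (t - s) = expSemigroup D (t - s) * C :=
      hCD.expSemigroup_right (t - s)
    simp only [Function.comp, neg_smul, one_smul, mul_sub, mul_neg, mul_assoc, hc]
    abel
  have hder' : ∀ s, HasDerivAt (fun s => (expSemigroup C s * expSemigroup D (t - s)) x)
      ((expSemigroup C s * expSemigroup D (t - s)) (C x - D x)) s := by
    intro s
    have h := (((ContinuousLinearMap.apply ℂ E x).restrictScalars ℝ).hasFDerivAt).comp_hasDerivAt s
      (hder s)
    simpa using! h
  have h := norm_image_sub_le_of_norm_deriv_le_segment' (a := 0) (b := t) (C := ‖C x - D x‖)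
    (fun s _ => (hder' s).hasDerivWithinAt)
    (fun s hs => (hC.norm_expSemigroup_apply_le hs.1 _).trans
      (hD.norm_expSemigroup_apply_le (sub_nonneg.2 hs.2.le) _)) t ⟨ht, le_rfl⟩
  simpa [mul_comm] using h

/-! ### Yosida approximation -/

namespace IsDissipative

variable {G : E →L[ℂ] E} (hG : IsDissipative G)
include hG

theorem isUnit_sub_smul_one {ε : ℝ} (hε : 0 < ε) : IsUnit (G - (ε : ℂ) • (1 : E →L[ℂ] E)) := by
  refine ContinuousLinearMap.isUnit_of_forall_le_norm_inner_map _ (c := ⟨ε, hε.le⟩) hε fun x => ?_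
  have h1 : (inner ℂ ((G - (ε : ℂ) • (1 : E →L[ℂ] E)) x) x : ℂ).re
      = (inner ℂ (G x) x : ℂ).re - ε * ‖x‖ ^ 2 := by
    rw [sub_apply, smul_apply, one_apply_eq_self, inner_sub_left, inner_smul_left, Complex.sub_re,
      Complex.conj_ofReal, Complex.re_ofReal_mul, norm_sq_eq_re_inner_self]
  have h2 := hG x
  have h3 := Complex.abs_re_le_norm (inner ℂ ((G - (ε : ℂ) • (1 : E →L[ℂ] E)) x) x : ℂ)
  rw [h1] at h3
  have h4 := neg_le_of_abs_le h3
  change ‖x‖ ^ 2 * ε ≤ _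
  linarith

theorem yosida_apply_apply {ε : ℝ} (hε : 0 < ε) (x : E) :
    yosida G ε (G x) = x + (ε : ℂ) • yosida G ε x := by
  have h := DFunLike.congr_fun (Ring.inverse_mul_cancel _ (hG.isUnit_sub_smul_one hε)) x
  simp only [mul_apply_eq_comp, sub_apply, map_sub,
    smul_apply, one_apply_eq_self, map_smul] at h
  rw [← sub_eq_iff_eq_add]
  exact h

theorem apply_yosida_apply {ε : ℝ} (hε : 0 < ε) (x : E) :
    G (yosida G ε x) = x + (ε : ℂ) • yosida G ε x := by
  have h := DFunLike.congr_fun (Ring.mul_inverse_cancel _ (hG.isUnit_sub_smul_one hε)) x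
  simp only [mul_apply_eq_comp, sub_apply,
    smul_apply, one_apply_eq_self] at h
  rw [← sub_eq_iff_eq_add]
  exact h

theorem commute_yosida {ε : ℝ} (hε : 0 < ε) : Commute G (yosida G ε) := by
  ext x
  simp [mul_apply_eq_comp, hG.apply_yosida_apply hε, hG.yosida_apply_apply hε]

theorem yosida_isDissipative {ε : ℝ} (hε : 0 < ε) : IsDissipative (yosida G ε) := by
  intro x
  have h1 := hG.apply_yosida_apply hε x
  have h2 := hG (yosida G ε x)
  rw [h1, inner_add_left, inner_smul_left, Complex.add_re, Complex.conj_ofReal,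
    Complex.re_ofReal_mul, ← norm_sq_eq_re_inner_self] at h2
  rw [re_inner_comm]
  nlinarith [sq_nonneg ‖yosida G ε x‖]

/-- The operators `(G - ε)⁻¹ G = (1 - ε B)⁻¹` are contractions. -/
theorem norm_yosida_apply_apply_le {ε : ℝ} (hε : 0 < ε) (x : E) : ‖yosida G ε (G x)‖ ≤ ‖x‖ := by
  have h1 := hG.yosida_apply_apply hε x
  have h2 := hG.yosida_isDissipative hε x
  have h3 : x = yosida G ε (G x) - (ε : ℂ) • yosida G ε x := by rw [h1]; abel
  have h4 : ‖yosida G ε (G x)‖ ^ 2 ≤ ‖x‖ ^ 2 := by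
    have e1 : ‖yosida G ε (G x)‖ ^ 2 = ‖x‖ ^ 2 + 2 * ε * (inner ℂ (yosida G ε x) x : ℂ).re
        + ε ^ 2 * ‖yosida G ε x‖ ^ 2 := by
      rw [h1, @norm_add_sq ℂ, norm_smul, inner_smul_right]
      simp [re_inner_comm x, abs_of_pos hε]
      ring
    have e2 := hG (yosida G ε x)
    rw [hG.apply_yosida_apply hε, inner_add_left, inner_smul_left, Complex.add_re,
      Complex.conj_ofReal, Complex.re_ofReal_mul, ← norm_sq_eq_re_inner_self, re_inner_comm] at e2
    nlinarith
  exact le_of_sq_le_sq h4 (norm_nonneg _)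

theorem norm_yosida_apply_apply_apply_sub_le {ε : ℝ} (hε : 0 < ε) (x : E) :
    ‖yosida G ε (G (G x)) - G x‖ ≤ ε * ‖x‖ := by
  rw [hG.yosida_apply_apply hε (G x), add_sub_cancel_left, norm_smul, Complex.norm_real,
    Real.norm_of_nonneg hε.le]
  exact mul_le_mul_of_nonneg_left (hG.norm_yosida_apply_apply_le hε x) hε.le

/-- An injective dissipative operator has dense range: a vector `y` orthogonal to the range
satisfies `Re ⟨G (x + c y), x + c y⟩ ≤ 0` for all scalars `c`, which forces `G y = 0`. -/
theorem denseRange (hinj : Function.Injective G) : DenseRange G := by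
  have hbot : G.rangeᗮ = ⊥ := by
    rw [Submodule.eq_bot_iff]
    intro y hy
    have hperp : ∀ x, inner ℂ (G x) y = (0 : ℂ) := fun x => hy (G x) ⟨x, rfl⟩
    have hre : ∀ x : E, (inner ℂ (G y) x : ℂ).re ≤ 0 := by
      intro x
      by_contra! hpos
      obtain ⟨n, hn⟩ := exists_nat_gt (-(inner ℂ (G x) x : ℂ).re / (inner ℂ (G y) x : ℂ).re)
      have h := hG (x + (n : ℂ) • y)
      simp only [map_add, map_smul, inner_add_left, inner_add_right, inner_smul_left,
        inner_smul_right, hperp, mul_zero, add_zero, Complex.add_re, Complex.conj_natCast] at h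
      rw [div_lt_iff₀ hpos] at hn
      have h3 : ((n : ℂ) * inner ℂ (G y) x).re = n * (inner ℂ (G y) x : ℂ).re := by
        simp
      linarith
    have h := hre (G y)
    rw [← norm_sq_eq_re_inner_self] at h
    have h0 : G y = 0 := by
      rw [← norm_eq_zero]
      nlinarith [norm_nonneg (G y)]
    exact hinj (h0.trans (map_zero G).symm)
  have := Submodule.dense_iff_topologicalClosure_eq_top.2
    (Submodule.topologicalClosure_eq_top_iff.2 hbot)
  exact this

end IsDissipative

end HilbertSemigroups

section GenerationAndStability

variable {E : Type*} [NormedAddCommGroup E] [InnerProductSpace ℂ E] [CompleteSpace E]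

/-! ### Generation of contraction semigroups -/

namespace IsDissipative

variable {G : E →L[ℂ] E} (hG : IsDissipative G)
include hG

theorem cauchySeq_expSemigroup_yosida (hinj : Function.Injective G) {t : ℝ} (ht : 0 ≤ t) (x : E) :
    CauchySeq fun n : ℕ => expSemigroup (yosida G (1 / ((n : ℝ) + 1))) t x := by
  have hε : ∀ n : ℕ, 0 < 1 / ((n : ℝ) + 1) := fun n => Nat.one_div_pos_of_nat
  refine cauchySeq_apply_of_dense
    (fun n x => (hG.yosida_isDissipative (hε n)).norm_expSemigroup_apply_le ht x)
    ((hG.denseRange hinj).comp (hG.denseRange hinj) G.continuous) ?_ x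
  rintro _ ⟨z, rfl⟩
  refine cauchySeq_of_le_tendsto_0 (fun N : ℕ => t * (2 * (1 / ((N : ℝ) + 1)) * ‖z‖)) ?_ ?_
  · intro n m N hn hm
    rw [dist_eq_norm]
    refine ((hG.yosida_isDissipative (hε n)).norm_expSemigroup_sub_expSemigroup_le
      (hG.yosida_isDissipative (hε m)) (commute_yosida_yosida G _ _) ht _).trans ?_
    refine mul_le_mul_of_nonneg_left ?_ ht
    have h1 := hG.norm_yosida_apply_apply_apply_sub_le (hε n) z
    have h2 := hG.norm_yosida_apply_apply_apply_sub_le (hε m) z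
    have h3 := norm_sub_le (yosida G (1 / ((n : ℝ) + 1)) (G (G z)) - G z)
      (yosida G (1 / ((m : ℝ) + 1)) (G (G z)) - G z)
    rw [sub_sub_sub_cancel_right] at h3
    have h4 := mul_le_mul_of_nonneg_right (Nat.one_div_le_one_div (α := ℝ) hn) (norm_nonneg z)
    have h5 := mul_le_mul_of_nonneg_right (Nat.one_div_le_one_div (α := ℝ) hm) (norm_nonneg z)
    refine h3.trans ?_
    linarith
  · have h := (((tendsto_one_div_add_atTop_nhds_zero_nat (𝕜 := ℝ)).const_mul 2).mul_const
      ‖z‖).const_mul t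
    simpa using h

theorem exists_tendsto_expSemigroup_yosida (hinj : Function.Injective G) (t : ℝ) :
    ∃ S : E →L[ℂ] E, 0 ≤ t → ∀ x,
      Tendsto (fun n : ℕ => expSemigroup (yosida G (1 / ((n : ℝ) + 1))) t x) atTop (𝓝 (S x)) := by
  by_cases ht : 0 ≤ t
  · choose f hf using fun x =>
      cauchySeq_tendsto_of_complete (hG.cauchySeq_expSemigroup_yosida hinj ht x)
    refine ⟨ContinuousLinearMap.ofTendstoOfBoundedRange f _ (tendsto_pi_nhds.2 hf) ?_,
      fun _ x => hf x⟩
    refine (Metric.isBounded_closedBall (x := (0 : E →L[ℂ] E)) (r := 1)).subset ?_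
    rintro _ ⟨n, rfl⟩
    rw [mem_closedBall_zero_iff]
    refine ContinuousLinearMap.opNorm_le_bound _ zero_le_one fun x => ?_
    rw [one_mul]
    exact (hG.yosida_isDissipative Nat.one_div_pos_of_nat).norm_expSemigroup_apply_le ht x
  · exact ⟨0, fun h => absurd h ht⟩

/-- The bounded-inverse form of the Lumer-Phillips theorem: if the bounded injective operator `G`
is dissipative, then `B = G⁻¹` generates a `C₀`-semigroup. The graph of `B` is written as the set
of all pairs `(G y, y)`. -/
theorem exists_isC0Semigroup (hinj : Function.Injective G) :
    ∃ S : ℝ → E →L[ℂ] E, IsC0Semigroup S ∧ ∀ x y : E, x = G y ↔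
      Tendsto (fun t : ℝ => ((t : ℂ)⁻¹) • (S t x - x)) (𝓝[>] 0) (𝓝 y) := by
  have hε : ∀ n : ℕ, 0 < 1 / ((n : ℝ) + 1) := fun n => Nat.one_div_pos_of_nat
  set Y : ℕ → E →L[ℂ] E := fun n => yosida G (1 / ((n : ℝ) + 1)) with hY
  have hYd : ∀ n, IsDissipative (Y n) := fun n => hG.yosida_isDissipative (hε n)
  have hYG : ∀ n x, Y n (G x) = G (Y n x) := fun n x =>
    (DFunLike.congr_fun (hG.commute_yosida (hε n)) x).symm
  choose S hS using hG.exists_tendsto_expSemigroup_yosida hinj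
  have hdense := hG.denseRange hinj
  have hcontr : ∀ t, 0 ≤ t → ∀ x, ‖S t x‖ ≤ ‖x‖ := fun t ht x =>
    le_of_tendsto (hS t ht x).norm
      (Eventually.of_forall fun n => (hYd n).norm_expSemigroup_apply_le ht x)
  have hlip : ∀ t, 0 ≤ t → ∀ y, ‖S t (G y) - G y‖ ≤ t * ‖y‖ := fun t ht y =>
    le_of_tendsto ((hS t ht (G y)).sub_const _).norm (Eventually.of_forall fun n =>
      ((hYd n).norm_expSemigroup_sub_le ht _).trans
        (mul_le_mul_of_nonneg_left (hG.norm_yosida_apply_apply_le (hε n) y) ht))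
  have hYlim : ∀ z, Tendsto (fun n => Y n (G (G z))) atTop (𝓝 (G z)) := by
    intro z
    rw [tendsto_iff_norm_sub_tendsto_zero]
    refine squeeze_zero (fun _ => norm_nonneg _)
      (fun n => hG.norm_yosida_apply_apply_apply_sub_le (hε n) z) ?_
    simpa using (tendsto_one_div_add_atTop_nhds_zero_nat (𝕜 := ℝ)).mul_const ‖z‖
  have htaylor : ∀ t, 0 ≤ t → ∀ y, ‖S t (G (G y)) - G (G y) - t • G y‖ ≤ t ^ 2 * ‖y‖ := by
    intro t ht y
    refine le_of_tendsto (((hS t ht _).sub_const _).sub ((hYlim y).const_smul t)).norm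
      (Eventually.of_forall fun n => ((hYd n).norm_expSemigroup_sub_sub_le ht _).trans
        (mul_le_mul_of_nonneg_left ?_ (sq_nonneg t)))
    rw [hYG n (G y)]
    exact (hG.norm_yosida_apply_apply_le (hε n) _).trans (hG.norm_yosida_apply_apply_le (hε n) _)
  have hSG : ∀ t, 0 ≤ t → ∀ x, S t (G x) = G (S t x) := by
    intro t ht x
    refine tendsto_nhds_unique (hS t ht (G x)) ?_
    have h := (G.continuous.tendsto _).comp (hS t ht x)
    refine h.congr fun n => ?_
    exact DFunLike.congr_fun ((hG.commute_yosida (hε n)).expSemigroup_right t) x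
  have hsub : ∀ t, 0 ≤ t → ∀ x y, ‖S t x - S t y‖ ≤ 1 * ‖x - y‖ := fun t ht x y => by
    rw [← map_sub, one_mul]
    exact hcontr t ht _
  have hcont : ∀ x : E, Tendsto (fun t : ℝ => S t x) (𝓝[>] 0) (𝓝 x) := by
    refine tendsto_apply_of_dense (T := fun t x => S t x) (T₀ := id) (K := 1)
      (eventually_mem_nhdsWithin.mono fun t (ht : 0 < t) => hsub t ht.le) (by simp) hdense ?_
    rintro _ ⟨y, rfl⟩
    rw [tendsto_iff_norm_sub_tendsto_zero]
    refine squeeze_zero' (Eventually.of_forall fun _ => norm_nonneg _)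
      (eventually_mem_nhdsWithin.mono fun t (ht : 0 < t) => hlip t ht.le y) ?_
    have h : Tendsto (fun t : ℝ => t * ‖y‖) (𝓝 0) (𝓝 (0 * ‖y‖)) := tendsto_id.mul_const _
    rw [zero_mul] at h
    exact h.mono_left nhdsWithin_le_nhds
  -- the difference quotients are equibounded by `hlip` and converge on the range of `G` by
  -- `htaylor`
  have hgen : ∀ y : E,
      Tendsto (fun t : ℝ => ((t : ℂ)⁻¹) • (S t (G y) - G y)) (𝓝[>] 0) (𝓝 y) := by
    refine tendsto_apply_of_dense (T := fun (t : ℝ) y => ((t : ℂ)⁻¹) • (S t (G y) - G y)) (T₀ := id)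
      (K := 1) (eventually_mem_nhdsWithin.mono fun t (ht : 0 < t) x y => ?_) (by simp) hdense ?_
    · rw [← smul_sub, sub_sub_sub_comm, ← map_sub, ← map_sub, norm_smul, norm_inv,
        Complex.norm_real, Real.norm_of_nonneg ht.le, one_mul, inv_mul_le_iff₀ ht]
      exact hlip t ht.le _
    · rintro _ ⟨y, rfl⟩
      rw [tendsto_iff_norm_sub_tendsto_zero]
      refine squeeze_zero' (Eventually.of_forall fun _ => norm_nonneg _)
        (eventually_mem_nhdsWithin.mono fun t (ht : 0 < t) => ?_) (g := fun t : ℝ => t * ‖y‖) ?_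
      · have h0 : (t : ℂ) ≠ 0 := Complex.ofReal_ne_zero.2 ht.ne'
        have h1 : ((t : ℂ)⁻¹) • (S t (G (G y)) - G (G y)) - id (G y)
            = ((t : ℂ)⁻¹) • (S t (G (G y)) - G (G y) - t • G y) := by
          rw [smul_sub _ _ (t • G y), ← Complex.coe_smul t (G y), smul_smul, inv_mul_cancel₀ h0,
            one_smul, id]
        rw [h1, norm_smul, norm_inv, Complex.norm_real, Real.norm_of_nonneg ht.le,
          inv_mul_le_iff₀ ht]
        exact (htaylor t ht.le y).trans_eq (by ring)
      · have h : Tendsto (fun t : ℝ => t * ‖y‖) (𝓝 0) (𝓝 (0 * ‖y‖)) := tendsto_id.mul_const _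
        rw [zero_mul] at h
        exact h.mono_left nhdsWithin_le_nhds
  refine ⟨S, ⟨?_, ?_, hcont⟩, fun x y => ⟨?_, fun h => ?_⟩⟩
  · ext x
    refine tendsto_nhds_unique (hS 0 le_rfl x) ?_
    simp
  · intro s t hs ht
    ext x
    refine tendsto_nhds_unique (hS (s + t) (add_nonneg hs ht) x) ?_
    have h1 : Tendsto (fun n => expSemigroup (Y n) s (expSemigroup (Y n) t x)
        - expSemigroup (Y n) s (S t x)) atTop (𝓝 0) := by
      refine squeeze_zero_norm (fun n => ?_)
        (tendsto_iff_norm_sub_tendsto_zero.1 (hS t ht x))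
      rw [← map_sub]
      exact (hYd n).norm_expSemigroup_apply_le hs _
    have h2 := h1.add (hS s hs (S t x))
    simpa [expSemigroup_add, hY] using h2
  · rintro rfl
    exact hgen y
  · -- `G` commutes with `S t`, so the limit of the difference quotients of `G x` is both `G y`
    -- and `x`
    refine tendsto_nhds_unique (hgen x) ?_
    refine ((G.continuous.tendsto y).comp h).congr' ?_
    filter_upwards [self_mem_nhdsWithin] with t ht
    simp [hSG t (le_of_lt ht)]

end IsDissipative

/-! ### Regularity of the orbits of a semigroup -/

namespace IsC0Semigroup

omit [CompleteSpace E] in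
theorem tendsto_nhdsGE_zero {S : ℝ → E →L[ℂ] E} (hS : IsC0Semigroup S) (x : E) :
    Tendsto (fun t : ℝ => S t x) (𝓝[≥] 0) (𝓝 x) := by
  have h : ContinuousWithinAt (fun t : ℝ => S t x) (Set.Ioi 0) 0 := by
    simpa [ContinuousWithinAt, hS.map_zero] using hS.tendsto_zero x
  rw [← Set.Ioi_insert]
  simpa [ContinuousWithinAt, hS.map_zero] using h.insert

/-- By the uniform boundedness principle a `C₀`-semigroup is bounded near `0`. -/
theorem exists_norm_le {S : ℝ → E →L[ℂ] E} (hS : IsC0Semigroup S) :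
    ∃ δ > 0, ∃ M, ∀ t ∈ Set.Icc 0 δ, ‖S t‖ ≤ M := by
  by_contra! hcon
  choose t ht hlt using fun n : ℕ => hcon (1 / ((n : ℝ) + 1)) Nat.one_div_pos_of_nat n
  have htend : Tendsto t atTop (𝓝[≥] 0) := by
    refine tendsto_nhdsWithin_iff.2 ⟨?_, Eventually.of_forall fun n => (ht n).1⟩
    exact squeeze_zero (fun n => (ht n).1) (fun n => (ht n).2)
      (tendsto_one_div_add_atTop_nhds_zero_nat (𝕜 := ℝ))
  obtain ⟨M, hM⟩ := banach_steinhaus (g := fun n => S (t n)) fun x => by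
    obtain ⟨C, hC⟩ := ((hS.tendsto_nhdsGE_zero x).comp htend).norm.bddAbove_range
    exact ⟨C, fun n => hC ⟨n, rfl⟩⟩
  obtain ⟨n, hn⟩ := exists_nat_gt M
  exact absurd (hM n) (not_le.2 (hn.trans (hlt n)))

theorem continuousOn {S : ℝ → E →L[ℂ] E} (hS : IsC0Semigroup S) (x : E) :
    ContinuousOn (fun t => S t x) (Set.Ici 0) := by
  obtain ⟨δ, hδ, M, hM⟩ := hS.exists_norm_le
  intro t₀ (ht₀ : 0 ≤ t₀)
  have hM0 : 0 ≤ M := (norm_nonneg _).trans (hM 0 ⟨le_rfl, hδ.le⟩)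
  -- near `t₀` every `S t` factors through `S s`, with `t - s ∈ [0, δ]`
  set s := max (t₀ - δ / 2) 0 with hs
  have hs0 : 0 ≤ s := le_max_right _ _
  have hst₀ : s ≤ t₀ := max_le (by linarith) ht₀
  have hsδ : t₀ - δ / 2 ≤ s := le_max_left _ _
  have hfac : ∀ t, s ≤ t → S t = (S s).comp (S (t - s)) := fun t ht => by
    rw [← hS.map_add s (t - s) hs0 (sub_nonneg.2 ht), add_sub_cancel]
  have habs : Tendsto (fun t : ℝ => |t - t₀|) (𝓝[Set.Ici 0] t₀) (𝓝[≥] 0) := by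
    refine tendsto_nhdsWithin_iff.2 ⟨?_, Eventually.of_forall fun _ => Set.mem_Ici.2 (abs_nonneg _)⟩
    have h : Tendsto (fun t : ℝ => |t - t₀|) (𝓝 t₀) (𝓝 |t₀ - t₀|) :=
      (tendsto_id.sub_const t₀).abs
    rw [sub_self, abs_zero] at h
    exact h.mono_left nhdsWithin_le_nhds
  have hlim := (tendsto_iff_norm_sub_tendsto_zero.1
    ((hS.tendsto_nhdsGE_zero x).comp habs)).const_mul (‖S s‖ * M)
  rw [mul_zero] at hlim
  change Tendsto _ _ _
  rw [tendsto_iff_norm_sub_tendsto_zero]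
  refine squeeze_zero' (Eventually.of_forall fun _ => norm_nonneg _) ?_ hlim
  have hnear : ∀ᶠ t in 𝓝[Set.Ici 0] t₀, |t - t₀| < δ / 2 := by
    have h := (habs.mono_right nhdsWithin_le_nhds).eventually (gt_mem_nhds (half_pos hδ))
    exact h
  filter_upwards [hnear, self_mem_nhdsWithin] with t ht (ht0 : 0 ≤ t)
  obtain ⟨ht1, ht2⟩ := abs_lt.1 ht
  have hbound : ∀ r, s ≤ r → r - s ≤ δ → ∀ z, ‖S r z‖ ≤ ‖S s‖ * M * ‖z‖ := by
    intro r hr hrδ z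
    rw [hfac r hr, ContinuousLinearMap.comp_apply, mul_assoc]
    exact ((S s).le_opNorm _).trans (mul_le_mul_of_nonneg_left
      (((S (r - s)).le_opNorm z).trans (mul_le_mul_of_nonneg_right
        (hM _ ⟨sub_nonneg.2 hr, hrδ⟩) (norm_nonneg z))) (norm_nonneg _))
  have hts : s ≤ t := max_le (by linarith) ht0
  rcases le_total t₀ t with h | h
  · have e : S t x - S t₀ x = S t₀ (S |t - t₀| x - x) := by
      rw [map_sub, abs_of_nonneg (sub_nonneg.2 h), ← ContinuousLinearMap.comp_apply,
        ← hS.map_add t₀ (t - t₀) ht₀ (sub_nonneg.2 h), add_sub_cancel]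
    rw [e]
    exact hbound t₀ hst₀ (by linarith) _
  · have e : S t x - S t₀ x = -S t (S |t - t₀| x - x) := by
      rw [map_sub, abs_sub_comm, abs_of_nonneg (sub_nonneg.2 h), ← ContinuousLinearMap.comp_apply,
        ← hS.map_add t (t₀ - t) ht0 (sub_nonneg.2 h), add_sub_cancel, neg_sub]
    rw [e, norm_neg]
    exact hbound t hts (by linarith) _

end IsC0Semigroup

/-! ### Exponential stability from a quadratic Lyapunov functional -/

variable {G : E →L[ℂ] E} {S : ℝ → E →L[ℂ] E}

omit [CompleteSpace E] in
/-- The domain of the generator is invariant under the semigroup, and orbits starting in it are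
right differentiable. -/
theorem hasDerivWithinAt_orbit (hS : IsC0Semigroup S)
    (hgen : ∀ x y : E, x = G y ↔
      Tendsto (fun t : ℝ => ((t : ℂ)⁻¹) • (S t x - x)) (𝓝[>] 0) (𝓝 y))
    (y : E) {t : ℝ} (ht : 0 ≤ t) :
    S t (G y) = G (S t y) ∧ HasDerivWithinAt (fun r => S r (G y)) (S t y) (Set.Ici t) t := by
  have hquot : Tendsto (fun h : ℝ => ((h : ℂ)⁻¹) • (S h (S t (G y)) - S t (G y))) (𝓝[>] 0)
      (𝓝 (S t y)) := by
    refine (((S t).continuous.tendsto y).comp ((hgen (G y) y).1 rfl)).congr' ?_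
    filter_upwards [self_mem_nhdsWithin] with h (hh : 0 < h)
    have hc : S t (S h (G y)) = S h (S t (G y)) := by
      rw [← ContinuousLinearMap.comp_apply, ← hS.map_add t h ht hh.le, add_comm,
        hS.map_add h t hh.le ht, ContinuousLinearMap.comp_apply]
    simp [hc]
  refine ⟨(hgen _ _).2 hquot, ?_⟩
  rw [← hasDerivWithinAt_Ioi_iff_Ici, hasDerivWithinAt_iff_tendsto_slope' (Set.self_notMem_Ioi)]
  have hshift : Tendsto (fun r : ℝ => r - t) (𝓝[>] t) (𝓝[>] 0) := by
    refine tendsto_nhdsWithin_iff.2 ⟨?_, ?_⟩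
    · have h : Tendsto (fun r : ℝ => r - t) (𝓝 t) (𝓝 (t - t)) := tendsto_id.sub_const t
      rw [sub_self] at h
      exact h.mono_left nhdsWithin_le_nhds
    · filter_upwards [self_mem_nhdsWithin] with r hr
      exact sub_pos.2 (Set.mem_Ioi.1 hr)
  refine (hquot.comp hshift).congr' ?_
  filter_upwards [self_mem_nhdsWithin] with r (hr : t < r)
  have hadd : S (r - t) (S t (G y)) = S r (G y) := by
    rw [← ContinuousLinearMap.comp_apply, ← hS.map_add _ t (sub_pos.2 hr).le ht, sub_add_cancel]
  rw [Function.comp, hadd, slope_def_module, ← Complex.ofReal_inv, Complex.coe_smul]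

/-- If `Re ⟨Q x, x⟩` is equivalent to `‖x‖²` and decreases along the solutions of `x' = G⁻¹ x` at
a rate at least `κ ‖x‖²`, then the semigroup generated by `G⁻¹` is exponentially stable. -/
theorem exponentiallyStable_of_lyapunov (hdense : DenseRange G) (hS : IsC0Semigroup S)
    (hgen : ∀ x y : E, x = G y ↔
      Tendsto (fun t : ℝ => ((t : ℂ)⁻¹) • (S t x - x)) (𝓝[>] 0) (𝓝 y))
    (Q : E →L[ℂ] E) {c κ : ℝ} (hc : 0 < c) (hκ : 0 < κ)
    (hQ : ∀ x, c * ‖x‖ ^ 2 ≤ (inner ℂ (Q x) x : ℂ).re)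
    (hdecay : ∀ y, (inner ℂ (Q (G y)) y : ℂ).re + (inner ℂ (Q y) (G y) : ℂ).re
      ≤ -κ * ‖G y‖ ^ 2) :
    ExponentiallyStable S := by
  set ω := κ / (‖Q‖ + 1) with hω
  have hQ1 : 0 < ‖Q‖ + 1 := by positivity
  have hω0 : 0 < ω := div_pos hκ hQ1
  have hQle : ∀ x, (inner ℂ (Q x) x : ℂ).re ≤ (‖Q‖ + 1) * ‖x‖ ^ 2 := by
    intro x
    have h1 := re_inner_le_norm_mul (Q x) x
    have h2 := mul_le_mul_of_nonneg_right (Q.le_opNorm x) (norm_nonneg x)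
    nlinarith [sq_nonneg ‖x‖]
  have hdiss : ∀ y, (inner ℂ (Q (G y)) y : ℂ).re + (inner ℂ (Q y) (G y) : ℂ).re
      + ω * (inner ℂ (Q (G y)) (G y) : ℂ).re ≤ 0 := by
    intro y
    have h1 := mul_le_mul_of_nonneg_left (hQle (G y)) hω0.le
    have h2 : ω * ((‖Q‖ + 1) * ‖G y‖ ^ 2) = κ * ‖G y‖ ^ 2 := by
      rw [hω]
      field_simp
    linarith [hdecay y]
  have hmono : ∀ y t, 0 ≤ t →
      Real.exp (ω * t) * (inner ℂ (Q (S t (G y))) (S t (G y)) : ℂ).re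
        ≤ (inner ℂ (Q (G y)) (G y) : ℂ).re := by
    intro y t ht
    have hder : ∀ r, 0 ≤ r → HasDerivWithinAt
        (fun r => Real.exp (ω * r) * (inner ℂ (Q (S r (G y))) (S r (G y)) : ℂ).re)
        (Real.exp (ω * r) * ((inner ℂ (Q (G (S r y))) (S r y) : ℂ).re
          + (inner ℂ (Q (S r y)) (G (S r y)) : ℂ).re
          + ω * (inner ℂ (Q (G (S r y))) (G (S r y)) : ℂ).re)) (Set.Ici r) r := by
      intro r hr
      obtain ⟨hcomm, hd⟩ := hasDerivWithinAt_orbit hS hgen y hr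
      have h1 := hasDerivWithinAt_re_inner_apply Q hd
      have h2 : HasDerivWithinAt (fun r => Real.exp (ω * r)) (Real.exp (ω * r) * (ω * 1))
          (Set.Ici r) r := (((hasDerivAt_id r).const_mul ω).exp).hasDerivWithinAt
      convert! h2.mul h1 using 1
      rw [hcomm]
      ring
    have hcont : ContinuousOn
        (fun r => Real.exp (ω * r) * (inner ℂ (Q (S r (G y))) (S r (G y)) : ℂ).re)
        (Set.Icc 0 t) := by
      have h1 : ContinuousOn (fun r => S r (G y)) (Set.Icc 0 t) :=
        (hS.continuousOn (G y)).mono Set.Icc_subset_Ici_self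
      have h2 : ContinuousOn (fun r => (inner ℂ (Q (S r (G y))) (S r (G y)) : ℂ).re)
          (Set.Icc 0 t) :=
        Complex.continuous_re.comp_continuousOn (ContinuousOn.inner (𝕜 := ℂ) (Q.continuous.comp_continuousOn h1) h1)
      exact (by fun_prop : Continuous fun r => Real.exp (ω * r)).continuousOn.mul h2
    have h := image_le_of_deriv_right_le_deriv_boundary hcont (fun r hr => hder r hr.1)
      (B := fun _ => (inner ℂ (Q (G y)) (G y) : ℂ).re) (B' := fun _ => 0)
      (by simp [hS.map_zero]) continuousOn_const (fun r _ => hasDerivWithinAt_const _ _ _)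
      (fun r _ => mul_nonpos_of_nonneg_of_nonpos (Real.exp_pos _).le (hdiss (S r y)))
    exact h ⟨ht, le_rfl⟩
  set K := (‖Q‖ + 1) / c with hK
  have hK0 : 0 < K := div_pos hQ1 hc
  have hbound : ∀ t, 0 ≤ t → ∀ x, ‖S t x‖ ≤ Real.sqrt K * Real.exp (-(ω / 2) * t) * ‖x‖ := by
    intro t ht x
    refine hdense.induction_on (p := fun x => ‖S t x‖ ≤
      Real.sqrt K * Real.exp (-(ω / 2) * t) * ‖x‖) x ?_ fun y => ?_
    · exact isClosed_le (S t).continuous.norm (continuous_const.mul continuous_norm)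
    · refine le_of_sq_le_sq ?_ (by positivity)
      have h1 := hmono y t ht
      have h2 := hQ (S t (G y))
      have h3 := hQle (G y)
      have e1 : Real.exp (-(ω / 2) * t) ^ 2 = (Real.exp (ω * t))⁻¹ := by
        rw [← Real.exp_neg, sq, ← Real.exp_add]
        congr 1
        ring
      rw [mul_pow, mul_pow, e1, Real.sq_sqrt hK0.le, hK]
      have e2 : (‖Q‖ + 1) / c * (Real.exp (ω * t))⁻¹ * ‖G y‖ ^ 2
          = ((‖Q‖ + 1) * ‖G y‖ ^ 2) / (Real.exp (ω * t) * c) := by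
        field_simp
      rw [e2, le_div_iff₀ (by positivity)]
      have h4 := mul_le_mul_of_nonneg_left h2 (Real.exp_pos (ω * t)).le
      linarith
  refine ⟨Real.sqrt K, ω / 2, Real.sqrt_pos.2 hK0, half_pos hω0, fun t ht => ?_⟩
  exact ContinuousLinearMap.opNorm_le_bound _ (by positivity) (hbound t ht)

/-- A dissipation rate `D` that controls the norm only up to the derivative of the bounded form
`Re ⟨Z x, W x⟩` is enough for exponential stability: a large multiple of `‖x‖²` plus that form is
a Lyapunov functional. -/
theorem exponentiallyStable_of_cross_term {F : Type*} [NormedAddCommGroup F]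
    [InnerProductSpace ℂ F] [CompleteSpace F] (hdense : DenseRange G) (hS : IsC0Semigroup S)
    (hgen : ∀ x y : E, x = G y ↔
      Tendsto (fun t : ℝ => ((t : ℂ)⁻¹) • (S t x - x)) (𝓝[>] 0) (𝓝 y))
    (Z W : E →L[ℂ] F) {D : E → ℝ} (hD : ∀ y, 0 ≤ D y)
    (hdiss : ∀ y, (inner ℂ (G y) y : ℂ).re ≤ -D y) {κ C : ℝ} (hκ : 0 < κ) (hC : 0 ≤ C)
    (hcross : ∀ y, (inner ℂ (Z (G y)) (W y) : ℂ).re + (inner ℂ (Z y) (W (G y)) : ℂ).re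
      ≤ -κ * ‖G y‖ ^ 2 + C * D y) :
    ExponentiallyStable S := by
  set N : ℝ := ‖Z‖ * ‖W‖ + 1 + C with hN
  set Q : E →L[ℂ] E := (N : ℂ) • (1 : E →L[ℂ] E) + (ContinuousLinearMap.adjoint W).comp Z with hQ
  have hinner : ∀ x y, (inner ℂ (Q x) y : ℂ).re
      = N * (inner ℂ x y : ℂ).re + (inner ℂ (Z x) (W y) : ℂ).re := by
    intro x y
    rw [hQ, add_apply, smul_apply, one_apply_eq_self, ContinuousLinearMap.comp_apply,
      inner_add_left, inner_smul_left, ContinuousLinearMap.adjoint_inner_left, Complex.add_re,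
      Complex.conj_ofReal, Complex.re_ofReal_mul]
  refine exponentiallyStable_of_lyapunov hdense hS hgen Q one_pos hκ (fun x => ?_) fun y => ?_
  · have h1 := neg_norm_mul_le_re_inner (Z x) (W x)
    have h2 := mul_le_mul (Z.le_opNorm x) (W.le_opNorm x) (norm_nonneg _) (by positivity)
    rw [hinner, ← norm_sq_eq_re_inner_self]
    nlinarith [mul_nonneg hC (sq_nonneg ‖x‖)]
  · have h1 := hdiss y
    have h2 := hcross y
    have h3 := hD y
    have hN0 : 0 ≤ ‖Z‖ * ‖W‖ + 1 := by positivity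
    rw [hinner, hinner, re_inner_comm y (G y)]
    nlinarith [mul_nonneg hC h3, mul_nonneg hN0 h3,
      mul_le_mul_of_nonneg_left h1 (add_nonneg hN0 hC)]

end GenerationAndStability

/-! ### Powers of the inverse operator and the space `D(A^{1/2})` -/

namespace StrictlyPositiveOperator

variable {H : Type*} [NormedAddCommGroup H] [InnerProductSpace ℂ H] [CompleteSpace H]
variable (P : StrictlyPositiveOperator H)

theorem negPow_half_apply_apply (x : H) : P.negPow (1 / 2) (P.negPow (1 / 2) x) = P.inv x := by
  have h := CFC.sqrt_mul_sqrt_self P.inv P.inv_nonneg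
  rw [CFC.sqrt_eq_rpow] at h
  exact DFunLike.congr_fun h x

theorem inner_negPow_left (s : ℝ) (x y : H) :
    inner ℂ (P.negPow s x) y = (inner ℂ x (P.negPow s y) : ℂ) := by
  have h : 0 ≤ P.negPow s := CFC.rpow_nonneg
  exact ((ContinuousLinearMap.nonneg_iff_isPositive _).1 h).isSymmetric x y

theorem negPow_comm (s t : ℝ) (x : H) :
    P.negPow s (P.negPow t x) = P.negPow t (P.negPow s x) := by
  have h : Commute (P.negPow s) (P.negPow t) := cfc_commute_cfc _ _ _
  exact DFunLike.congr_fun h x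

theorem negPow_half_mem_DHalf (x : H) : P.negPow (1 / 2) x ∈ P.DHalf := by
  change P.negPow (1 / 2) x ∈ ((P.negPow (1 / 2) : H →ₗ[ℂ] H).toPMap ⊤).inverse.domain
  rw [LinearPMap.inverse_domain]
  exact ⟨⟨x, trivial⟩, rfl⟩

/-- The operator `A^{1/2}` as a bijection from its domain onto `H`; the inverse is `A^{-1/2}`. -/
noncomputable def halfEquiv : P.DHalf ≃ₗ[ℂ] H where
  __ := P.AHalf
  invFun x := ⟨P.negPow (1 / 2) x, P.negPow_half_mem_DHalf x⟩
  left_inv x := Subtype.ext (P.negPow_AHalf x)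
  right_inv x := P.negPow_half_injective (P.negPow_AHalf ⟨P.negPow (1 / 2) x, _⟩)

theorem mem_domain_and_apply_eq_iff (x y : H) :
    (∃ h : x ∈ P.A.domain, P.A ⟨x, h⟩ = y) ↔ x = P.inv y := by
  constructor
  · rintro ⟨h, rfl⟩
    exact (P.inv_apply_A ⟨x, h⟩).symm
  · rintro rfl
    exact ⟨P.inv_mem_domain y, P.A_inv_apply y⟩

end StrictlyPositiveOperator

/-! ### Energy coordinates on the phase space -/

namespace MGTFourier

variable {H : Type*} [NormedAddCommGroup H] [InnerProductSpace ℂ H] [CompleteSpace H]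
variable (P : MGTFourier H)

/-- The coordinates `(A^{1/2} v, A^{1/2} (u + α v), v + α w, θ)` in `H⁴`, in which the energy
inner product is a weighted sum of inner products of `H`. -/
noncomputable def coordLinearEquiv : P.PhaseSpace ≃ₗ[ℂ] H × H × H × H where
  toFun U := (P.AHalf (P.v U), P.AHalf (P.u U) + (P.α : ℂ) • P.AHalf (P.v U),
    (P.v U : H) + (P.α : ℂ) • P.w U, P.θ U)
  map_add' U V := by
    simp only [map_add, Submodule.coe_add, smul_add, Prod.mk_add_mk]
    refine Prod.ext rfl (Prod.ext ?_ (Prod.ext ?_ rfl))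
    · exact add_add_add_comm _ _ _ _
    · exact add_add_add_comm _ _ _ _
  map_smul' r U := by
    simp only [map_smul, Submodule.coe_smul, smul_comm _ r, ← smul_add, RingHom.id_apply,
      Prod.smul_mk]
  invFun X := P.state (P.halfEquiv.symm (X.2.1 - (P.α : ℂ) • X.1)) (P.halfEquiv.symm X.1)
    ((P.α : ℂ)⁻¹ • (X.2.2.1 - P.negPow (1 / 2) X.1)) X.2.2.2
  left_inv U := by
    have hα : (P.α : ℂ) ≠ 0 := Complex.ofReal_ne_zero.2 P.α_pos.ne'
    refine P.ext_components ?_ ?_ ?_ rfl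
    · change P.halfEquiv.symm (P.AHalf (P.u U) + (P.α : ℂ) • P.AHalf (P.v U)
        - (P.α : ℂ) • P.AHalf (P.v U)) = P.u U
      rw [add_sub_cancel_right]
      exact P.halfEquiv.left_inv (P.u U)
    · exact P.halfEquiv.left_inv (P.v U)
    · change (P.α : ℂ)⁻¹ • ((P.v U : H) + (P.α : ℂ) • P.w U
        - P.negPow (1 / 2) (P.AHalf (P.v U))) = P.w U
      rw [P.negPow_AHalf, add_sub_cancel_left, smul_smul, inv_mul_cancel₀ hα, one_smul]
  right_inv X := by
    have hα : (P.α : ℂ) ≠ 0 := Complex.ofReal_ne_zero.2 P.α_pos.ne'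
    have h : ∀ x, P.AHalf (P.halfEquiv.symm x) = x := P.halfEquiv.right_inv
    refine Prod.ext (h _) (Prod.ext ?_ (Prod.ext ?_ rfl))
    · change P.AHalf (P.halfEquiv.symm (X.2.1 - (P.α : ℂ) • X.1))
        + (P.α : ℂ) • P.AHalf (P.halfEquiv.symm X.1) = X.2.1
      rw [h, h, sub_add_cancel]
    · change P.negPow (1 / 2) X.1
        + (P.α : ℂ) • ((P.α : ℂ)⁻¹ • (X.2.2.1 - P.negPow (1 / 2) X.1)) = X.2.2.1
      rw [smul_smul, mul_inv_cancel₀ hα, one_smul, add_sub_cancel]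

theorem energy_coeff_pos : 0 < P.a ^ 2 * P.α * (P.β - P.α) := by
  have h1 := sub_pos.2 P.α_lt_β
  have h2 := P.α_pos
  have h3 := P.a_ne_zero
  positivity

theorem a_sq_pos : 0 < P.a ^ 2 := by
  have h3 := P.a_ne_zero
  positivity

theorem inner_eq_coord (U V : P.PhaseSpace) :
    (inner ℂ U V : ℂ) = ((P.a ^ 2 * P.α * (P.β - P.α) : ℝ) : ℂ)
        * inner ℂ (P.coordLinearEquiv U).1 (P.coordLinearEquiv V).1
      + ((P.a ^ 2 : ℝ) : ℂ) * inner ℂ (P.coordLinearEquiv U).2.1 (P.coordLinearEquiv V).2.1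
      + inner ℂ (P.coordLinearEquiv U).2.2.1 (P.coordLinearEquiv V).2.2.1
      + inner ℂ (P.coordLinearEquiv U).2.2.2 (P.coordLinearEquiv V).2.2.2 := rfl

theorem norm_sq_eq_coord (U : P.PhaseSpace) :
    ‖U‖ ^ 2 = P.a ^ 2 * P.α * (P.β - P.α) * ‖(P.coordLinearEquiv U).1‖ ^ 2
      + P.a ^ 2 * ‖(P.coordLinearEquiv U).2.1‖ ^ 2
      + ‖(P.coordLinearEquiv U).2.2.1‖ ^ 2 + ‖(P.coordLinearEquiv U).2.2.2‖ ^ 2 := by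
  rw [norm_sq_eq_re_inner_self]
  exact P.energyInner_self_re U

theorem norm_coord_le (U : P.PhaseSpace) :
    ‖P.coordLinearEquiv U‖ ≤ ((P.a ^ 2 * P.α * (P.β - P.α))⁻¹ + (P.a ^ 2)⁻¹ + 1) ^ (1 / 2 : ℝ)
      * ‖U‖ := by
  have h1 := P.energy_coeff_pos
  have h2 := P.a_sq_pos
  set c := P.a ^ 2 * P.α * (P.β - P.α)
  set d := P.a ^ 2
  have hU := P.norm_sq_eq_coord U
  have hc : c⁻¹ * c = 1 := inv_mul_cancel₀ h1.ne'
  have hd : d⁻¹ * d = 1 := inv_mul_cancel₀ h2.ne'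
  have hc0 : 0 < c⁻¹ := inv_pos.2 h1
  have hd0 : 0 < d⁻¹ := inv_pos.2 h2
  have key : ∀ r : ℝ, 0 ≤ r → r ^ 2 ≤ (c⁻¹ + d⁻¹ + 1) * ‖U‖ ^ 2 →
      r ≤ (c⁻¹ + d⁻¹ + 1) ^ (1 / 2 : ℝ) * ‖U‖ := by
    intro r hr h
    refine le_of_sq_le_sq ?_ (by positivity)
    rwa [mul_pow, ← Real.sqrt_eq_rpow, Real.sq_sqrt (by positivity)]
  have q1 := sq_nonneg ‖(P.coordLinearEquiv U).1‖
  have q2 := sq_nonneg ‖(P.coordLinearEquiv U).2.1‖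
  have q3 := sq_nonneg ‖(P.coordLinearEquiv U).2.2.1‖
  have q4 := sq_nonneg ‖(P.coordLinearEquiv U).2.2.2‖
  have b1 : c⁻¹ * (c * ‖(P.coordLinearEquiv U).1‖ ^ 2) ≤ c⁻¹ * ‖U‖ ^ 2 :=
    mul_le_mul_of_nonneg_left (by nlinarith) hc0.le
  have b2 : d⁻¹ * (d * ‖(P.coordLinearEquiv U).2.1‖ ^ 2) ≤ d⁻¹ * ‖U‖ ^ 2 :=
    mul_le_mul_of_nonneg_left (by nlinarith) hd0.le
  have b3 : ‖(P.coordLinearEquiv U).2.2.1‖ ^ 2 ≤ ‖U‖ ^ 2 := by nlinarith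
  have b4 : ‖(P.coordLinearEquiv U).2.2.2‖ ^ 2 ≤ ‖U‖ ^ 2 := by nlinarith
  rw [← mul_assoc, hc, one_mul] at b1
  rw [← mul_assoc, hd, one_mul] at b2
  have b5 := mul_nonneg hc0.le (sq_nonneg ‖U‖)
  have b6 := mul_nonneg hd0.le (sq_nonneg ‖U‖)
  refine max_le (key _ (norm_nonneg _) ?_) (max_le (key _ (norm_nonneg _) ?_)
    (max_le (key _ (norm_nonneg _) ?_) (key _ (norm_nonneg _) ?_))) <;> nlinarith [sq_nonneg ‖U‖]

theorem norm_le_coord (U : P.PhaseSpace) :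
    ‖U‖ ≤ (P.a ^ 2 * P.α * (P.β - P.α) + P.a ^ 2 + 2) ^ (1 / 2 : ℝ)
      * ‖P.coordLinearEquiv U‖ := by
  have h1 := P.energy_coeff_pos
  have h2 := P.a_sq_pos
  set c := P.a ^ 2 * P.α * (P.β - P.α)
  set d := P.a ^ 2
  refine le_of_sq_le_sq ?_ (by positivity)
  rw [mul_pow, ← Real.sqrt_eq_rpow, Real.sq_sqrt (by positivity), P.norm_sq_eq_coord U]
  set X := P.coordLinearEquiv U
  have p1 : ‖X.1‖ ^ 2 ≤ ‖X‖ ^ 2 := by gcongr; exact norm_fst_le X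
  have n2 : ‖X.2‖ ≤ ‖X‖ := norm_snd_le X
  have n3 : ‖X.2.2‖ ≤ ‖X‖ := (norm_snd_le X.2).trans n2
  have p2 : ‖X.2.1‖ ^ 2 ≤ ‖X‖ ^ 2 := by gcongr; exact (norm_fst_le X.2).trans n2
  have p3 : ‖X.2.2.1‖ ^ 2 ≤ ‖X‖ ^ 2 := by gcongr; exact (norm_fst_le X.2.2).trans n3
  have p4 : ‖X.2.2.2‖ ^ 2 ≤ ‖X‖ ^ 2 := by gcongr; exact (norm_snd_le X.2.2).trans n3
  have p5 := mul_le_mul_of_nonneg_left p1 h1.le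
  have p6 := mul_le_mul_of_nonneg_left p2 h2.le
  linarith

/-- The coordinates `(A^{1/2} v, A^{1/2} (u + α v), v + α w, θ)` as an isomorphism of the phase
space with `H⁴`. -/
noncomputable def coord : P.PhaseSpace ≃L[ℂ] H × H × H × H :=
  P.coordLinearEquiv.toContinuousLinearEquivOfBounds _ _ P.norm_coord_le fun X => by
    simpa using P.norm_le_coord (P.coordLinearEquiv.symm X)

instance : CompleteSpace P.PhaseSpace :=
  (completeSpace_congr (e := P.coord.toEquiv) P.coord.isUniformEmbedding).2 inferInstance

/-! ### The inverse of the evolution operator -/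

/-- The inverse of the evolution operator in energy coordinates: with
`τ = -(A^{-1/2} θ' + η A^{φ-1} p')`, it maps `(y', p', z', θ')` to
`(p' - α y', a⁻² (η A^{φ-1} τ - A^{-1/2} z') - (β - α) (p' - α y'), A^{-1/2} p', A^{-1/2} τ)`. -/
noncomputable def coordInverse (φ : ℝ) : (H × H × H × H) →L[ℂ] H × H × H × H :=
  let T : H →L[ℂ] H := P.negPow (1 / 2)
  let R : H →L[ℂ] H := P.negPow (1 - φ)
  let y' := ContinuousLinearMap.fst ℂ H (H × H × H)
  let p' := (ContinuousLinearMap.fst ℂ H (H × H)).comp (ContinuousLinearMap.snd ℂ H (H × H × H))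
  let r' := (ContinuousLinearMap.snd ℂ H (H × H)).comp (ContinuousLinearMap.snd ℂ H (H × H × H))
  let z' := (ContinuousLinearMap.fst ℂ H H).comp r'
  let θ' := (ContinuousLinearMap.snd ℂ H H).comp r'
  let τ := -(T.comp θ' + (P.η : ℂ) • R.comp p')
  let y := p' - (P.α : ℂ) • y'
  y.prod (((((P.a ^ 2 : ℝ) : ℂ)⁻¹ • ((P.η : ℂ) • R.comp τ - T.comp z'))
    - ((P.β - P.α : ℝ) : ℂ) • y).prod ((T.comp p').prod (T.comp τ)))

/-- The bounded inverse of the evolution operator. -/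
noncomputable def evolutionInverse (φ : ℝ) : P.PhaseSpace →L[ℂ] P.PhaseSpace :=
  (P.coord.symm : (H × H × H × H) →L[ℂ] P.PhaseSpace).comp
    ((P.coordInverse φ).comp (P.coord : P.PhaseSpace →L[ℂ] H × H × H × H))

theorem coord_evolutionInverse (φ : ℝ) (F : P.PhaseSpace) :
    P.coordLinearEquiv (P.evolutionInverse φ F) = P.coordInverse φ (P.coordLinearEquiv F) :=
  P.coord.apply_symm_apply _

theorem mem_evolution_graph_iff_components (φ : ℝ) (U F : P.PhaseSpace) :
    (U, F) ∈ (P.evolution φ).graph ↔ P.v U = P.u F ∧ P.w U = P.v F ∧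
      P.stress φ U = -P.inv ((P.v F : H) + (P.α : ℂ) • P.w F) ∧
      P.flux φ U = -P.inv (P.θ F) := by
  have hα : (P.α : ℂ) ≠ 0 := Complex.ofReal_ne_zero.2 P.α_pos.ne'
  rw [LinearPMap.mem_graph_iff]
  constructor
  · rintro ⟨⟨U, hU⟩, rfl, rfl⟩
    refine ⟨rfl, rfl, ?_, ?_⟩
    · rw [← map_neg]
      refine (P.mem_domain_and_apply_eq_iff _ _).1 ⟨hU.1.2, ?_⟩
      change P.A ⟨P.stress φ U, hU.1.2⟩
        = -(P.w U + (P.α : ℂ) • (-(P.α : ℂ)⁻¹ • (P.A ⟨P.stress φ U, hU.1.2⟩ + P.w U)))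
      rw [smul_smul, mul_neg, mul_inv_cancel₀ hα, neg_one_smul]
      abel
    · rw [← map_neg]
      refine (P.mem_domain_and_apply_eq_iff _ _).1 ⟨hU.2, ?_⟩
      exact (neg_neg _).symm
  · rintro ⟨h1, h2, h3, h4⟩
    rw [← map_neg] at h3 h4
    obtain ⟨d3, e3⟩ := (P.mem_domain_and_apply_eq_iff _ _).2 h3
    obtain ⟨d4, e4⟩ := (P.mem_domain_and_apply_eq_iff _ _).2 h4
    have d2 : P.w U ∈ P.DHalf := by rw [h2]; exact (P.v F).2
    refine ⟨⟨U, ⟨d2, d3⟩, d4⟩, rfl, P.ext_components h1 (Subtype.ext h2) ?_ ?_⟩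
    · change -(P.α : ℂ)⁻¹ • (P.A ⟨P.stress φ U, d3⟩ + P.w U) = P.w F
      rw [e3, h2, neg_add_rev, neg_add_cancel_right, neg_smul, smul_neg, neg_neg,
        smul_smul, inv_mul_cancel₀ hα, one_smul]
    · change -P.A ⟨P.flux φ U, d4⟩ = P.θ F
      rw [e4, neg_neg]

theorem stress_apply (φ : ℝ) (U : P.PhaseSpace) : P.stress φ U = ((P.a ^ 2 : ℝ) : ℂ) • (P.u U : H)
    + ((P.a ^ 2 * P.β : ℝ) : ℂ) • (P.v U : H) - (P.η : ℂ) • P.negPow (1 - φ) (P.θ U) := rfl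

theorem flux_apply (φ : ℝ) (U : P.PhaseSpace) :
    P.flux φ U = (P.η : ℂ) • P.negPow (1 - φ) (P.v U : H)
      + ((P.α * P.η : ℝ) : ℂ) • P.negPow (1 - φ) (P.w U) + P.θ U := rfl

/-- The formula for `coordInverse` results from applying `A^{-1/2}`, which is injective, to the
second coordinate and using `A^{-1/2} A^{-1/2} = A⁻¹` in the others. -/
theorem coord_eq_coordInverse_iff (φ : ℝ) (U F : P.PhaseSpace) :
    P.coordLinearEquiv U = P.coordInverse φ (P.coordLinearEquiv F) ↔ P.v U = P.u F ∧
      P.w U = P.v F ∧ P.stress φ U = -P.inv ((P.v F : H) + (P.α : ℂ) • P.w F) ∧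
      P.flux φ U = -P.inv (P.θ F) := by
  have hα : (P.α : ℂ) ≠ 0 := Complex.ofReal_ne_zero.2 P.α_pos.ne'
  have ha : (P.a : ℂ) ≠ 0 := Complex.ofReal_ne_zero.2 P.a_ne_zero
  have hinjA : Function.Injective P.AHalf := P.halfEquiv.injective
  have hT := P.negPow_half_apply_apply
  have hTA := P.negPow_AHalf
  have hTR := P.negPow_comm (1 / 2) (1 - φ)
  have e1 : P.AHalf (P.v U) = (P.AHalf (P.u F) + (P.α : ℂ) • P.AHalf (P.v F))
      - (P.α : ℂ) • P.AHalf (P.v F) ↔ P.v U = P.u F := by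
    rw [add_sub_cancel_right]
    exact hinjA.eq_iff
  have e3 : P.v U = P.u F → ((P.v U : H) + (P.α : ℂ) • P.w U
      = P.negPow (1 / 2) (P.AHalf (P.u F) + (P.α : ℂ) • P.AHalf (P.v F))
      ↔ P.w U = P.v F) := by
    intro h
    rw [map_add, map_smul, hTA, hTA, h, add_right_inj]
    exact smul_right_inj hα
  have e4 : P.v U = P.u F → P.w U = P.v F → (P.θ U = P.negPow (1 / 2)
      (-(P.negPow (1 / 2) (P.θ F) + (P.η : ℂ) • P.negPow (1 - φ)
        (P.AHalf (P.u F) + (P.α : ℂ) • P.AHalf (P.v F)))) ↔ P.flux φ U = -P.inv (P.θ F)) := by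
    intro h h'
    rw [map_neg, map_add, hT, map_smul, hTR, map_add, map_smul, hTA, hTA, flux_apply, h, h',
      map_add, map_smul, eq_neg_iff_add_eq_zero, eq_neg_iff_add_eq_zero]
    refine iff_of_eq (congrArg (· = 0) ?_)
    push_cast
    module
  have e2 : P.v U = P.u F → P.θ U = P.negPow (1 / 2) (-(P.negPow (1 / 2) (P.θ F)
        + (P.η : ℂ) • P.negPow (1 - φ) (P.AHalf (P.u F) + (P.α : ℂ) • P.AHalf (P.v F)))) →
      (P.AHalf (P.u U) + (P.α : ℂ) • P.AHalf (P.v U) = ((P.a ^ 2 : ℝ) : ℂ)⁻¹ •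
          ((P.η : ℂ) • P.negPow (1 - φ) (-(P.negPow (1 / 2) (P.θ F)
        + (P.η : ℂ) • P.negPow (1 - φ) (P.AHalf (P.u F) + (P.α : ℂ) • P.AHalf (P.v F))))
            - P.negPow (1 / 2) ((P.v F : H) + (P.α : ℂ) • P.w F))
        - ((P.β - P.α : ℝ) : ℂ) • ((P.AHalf (P.u F) + (P.α : ℂ) • P.AHalf (P.v F))
          - (P.α : ℂ) • P.AHalf (P.v F))
        ↔ P.stress φ U = -P.inv ((P.v F : H) + (P.α : ℂ) • P.w F)) := by
    intro h h'
    rw [← P.negPow_half_injective.eq_iff, map_sub, map_smul, map_smul, map_sub, map_smul, hTR, ← h',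
      map_add, map_smul, hTA, hTA, hT, add_sub_cancel_right, hTA, stress_apply, ← h]
    set ρ := P.negPow (1 - φ) (P.θ U)
    set ι := P.inv ((P.v F : H) + (P.α : ℂ) • P.w F)
    rw [← sub_eq_zero, eq_neg_iff_add_eq_zero]
    have key : ((P.a ^ 2 : ℝ) : ℂ) • (P.u U : H) + ((P.a ^ 2 * P.β : ℝ) : ℂ) • (P.v U : H)
        - (P.η : ℂ) • ρ + ι = ((P.a ^ 2 : ℝ) : ℂ) • ((P.u U : H) + (P.α : ℂ) • (P.v U : H)
        - (((P.a ^ 2 : ℝ) : ℂ)⁻¹ • ((P.η : ℂ) • ρ - ι)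
          - ((P.β - P.α : ℝ) : ℂ) • (P.v U : H))) := by
      push_cast
      (match_scalars <;> field_simp); ring
    rw [key, smul_eq_zero, or_iff_right]
    push_cast
    exact pow_ne_zero 2 ha
  constructor
  · intro h
    have h1 := congrArg Prod.fst h
    have h2 := congrArg (fun X => X.2.1) h
    have h3 := congrArg (fun X => X.2.2.1) h
    have h4 := congrArg (fun X => X.2.2.2) h
    have g1 := e1.1 h1
    have g3 := (e3 g1).1 h3
    exact ⟨g1, g3, (e2 g1 h4).1 h2, (e4 g1 g3).1 h4⟩
  · rintro ⟨g1, g2, g3, g4⟩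
    have h4 := (e4 g1 g2).2 g4
    exact Prod.ext (e1.2 g1) (Prod.ext ((e2 g1 h4).2 g3) (Prod.ext ((e3 g1).2 g2) h4))

theorem mem_evolution_graph_iff (φ : ℝ) (U F : P.PhaseSpace) :
    (U, F) ∈ (P.evolution φ).graph ↔ U = P.evolutionInverse φ F := by
  rw [mem_evolution_graph_iff_components, ← coord_eq_coordInverse_iff, ← coord_evolutionInverse,
    P.coordLinearEquiv.injective.eq_iff]

/-- The evolution operator is single-valued, so its inverse is injective. -/
theorem evolutionInverse_injective (φ : ℝ) : Function.Injective (P.evolutionInverse φ) := by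
  intro F F' h
  exact (P.evolution φ).mem_graph_snd_inj ((P.mem_evolution_graph_iff φ _ F).2 rfl)
    ((P.mem_evolution_graph_iff φ _ F').2 h) rfl

/-! ### Dissipation of energy and the Lyapunov functional -/

/-- The vector `A^{1/2} θ` for the state `evolutionInverse φ F`. -/
noncomputable def temperatureGradient (φ : ℝ) (F : P.PhaseSpace) : H :=
  -(P.negPow (1 / 2) (P.coordLinearEquiv F).2.2.2
    + (P.η : ℂ) • P.negPow (1 - φ) (P.coordLinearEquiv F).2.1)

/-- The relations between the coordinates of a state `U` in the domain of the evolution operator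
and those of its image `F`. -/
theorem coord_relations (φ : ℝ) (F : P.PhaseSpace) {y p z θ y' p' z' θ' τ : H}
    (hU : P.coordLinearEquiv (P.evolutionInverse φ F) = (y, p, z, θ))
    (hF : P.coordLinearEquiv F = (y', p', z', θ')) (hτ : P.temperatureGradient φ F = τ) :
    (P.α : ℂ) • y' = p' - y ∧ z = P.negPow (1 / 2) p' ∧ θ = P.negPow (1 / 2) τ ∧
      P.negPow (1 / 2) z' = (P.η : ℂ) • P.negPow (1 - φ) τ
        - ((P.a ^ 2 : ℝ) : ℂ) • (p + ((P.β - P.α : ℝ) : ℂ) • y) ∧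
      P.negPow (1 / 2) θ' = -τ - (P.η : ℂ) • P.negPow (1 - φ) p' := by
  have ha : (P.a : ℂ) ≠ 0 := Complex.ofReal_ne_zero.2 P.a_ne_zero
  have ha2 : ((P.a ^ 2 : ℝ) : ℂ) ≠ 0 := by push_cast; exact pow_ne_zero 2 ha
  have hτ' : τ = -(P.negPow (1 / 2) θ' + (P.η : ℂ) • P.negPow (1 - φ) p') := by
    rw [← hτ, temperatureGradient, hF]
  rw [coord_evolutionInverse, hF] at hU
  have h1 : p' - (P.α : ℂ) • y' = y := congrArg Prod.fst hU
  have h2 : ((P.a ^ 2 : ℝ) : ℂ)⁻¹ • ((P.η : ℂ) • P.negPow (1 - φ)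
      (-(P.negPow (1 / 2) θ' + (P.η : ℂ) • P.negPow (1 - φ) p')) - P.negPow (1 / 2) z')
      - ((P.β - P.α : ℝ) : ℂ) • (p' - (P.α : ℂ) • y') = p := congrArg (fun X => X.2.1) hU
  have h3 : P.negPow (1 / 2) p' = z := congrArg (fun X => X.2.2.1) hU
  have h4 : P.negPow (1 / 2) (-(P.negPow (1 / 2) θ' + (P.η : ℂ) • P.negPow (1 - φ) p')) = θ :=
    congrArg (fun X => X.2.2.2) hU
  rw [← hτ'] at h2 h4
  rw [h1] at h2
  refine ⟨?_, h3.symm, h4.symm, ?_, ?_⟩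
  · rw [← h1]
    abel
  · rw [← h2, sub_add_cancel, smul_smul, mul_inv_cancel₀ ha2, one_smul]
    abel
  · rw [hτ']
    abel

/-- The energy identity: energy is dissipated through `A^{1/2} u_t` and `A^{1/2} θ`. -/
theorem re_inner_evolutionInverse (φ : ℝ) (F : P.PhaseSpace) :
    (inner ℂ (P.evolutionInverse φ F) F : ℂ).re
      = -(P.a ^ 2 * (P.β - P.α) * ‖(P.coordLinearEquiv (P.evolutionInverse φ F)).1‖ ^ 2
        + ‖P.temperatureGradient φ F‖ ^ 2) := by
  obtain ⟨y, p, z, θ, hU⟩ : ∃ y p z θ,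
    P.coordLinearEquiv (P.evolutionInverse φ F) = (y, p, z, θ) := ⟨_, _, _, _, rfl⟩
  obtain ⟨y', p', z', θ', hF⟩ : ∃ y' p' z' θ',
    P.coordLinearEquiv F = (y', p', z', θ') := ⟨_, _, _, _, rfl⟩
  obtain ⟨τ, hτ⟩ : ∃ τ, P.temperatureGradient φ F = τ := ⟨_, rfl⟩
  obtain ⟨hy', hz, hθ, hTz', hTθ'⟩ := P.coord_relations φ F hU hF hτ
  rw [inner_eq_coord, hU, hF, hτ]
  simp only [Complex.add_re, Complex.re_ofReal_mul]
  -- the coupling terms `± η Re ⟨p', A^{φ-1} τ⟩` in `i2` and `i3` cancel in the sum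
  have i1 : P.α * (inner ℂ y y' : ℂ).re = (inner ℂ y p' : ℂ).re - ‖y‖ ^ 2 := by
    have h := congrArg (fun x => (inner ℂ y x : ℂ).re) hy'
    simpa [inner_smul_right, inner_sub_right, norm_sq_eq_re_inner_self] using h
  have i2 : (inner ℂ z z' : ℂ).re = P.η * (inner ℂ p' (P.negPow (1 - φ) τ) : ℂ).re
      - P.a ^ 2 * ((inner ℂ p' p : ℂ).re + (P.β - P.α) * (inner ℂ p' y : ℂ).re) := by
    rw [hz, P.inner_negPow_left, hTz', inner_sub_right, inner_smul_right, inner_smul_right,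
      inner_add_right, inner_smul_right, Complex.sub_re, Complex.re_ofReal_mul,
      Complex.re_ofReal_mul, Complex.add_re, Complex.re_ofReal_mul]
  have i3 : (inner ℂ θ θ' : ℂ).re
      = -‖τ‖ ^ 2 - P.η * (inner ℂ p' (P.negPow (1 - φ) τ) : ℂ).re := by
    rw [hθ, P.inner_negPow_left, hTθ', inner_sub_right, inner_smul_right, inner_neg_right,
      ← P.inner_negPow_left, Complex.sub_re, Complex.re_ofReal_mul, Complex.neg_re,
      re_inner_comm p', ← norm_sq_eq_re_inner_self]
  rw [i2, i3, re_inner_comm p' p, re_inner_comm p' y]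
  linear_combination P.a ^ 2 * (P.β - P.α) * i1

/-- The map `U ↦ v + α w`. -/
noncomputable def momentum : P.PhaseSpace →L[ℂ] H :=
  (ContinuousLinearMap.fst ℂ H H).comp ((ContinuousLinearMap.snd ℂ H (H × H)).comp
    ((ContinuousLinearMap.snd ℂ H (H × H × H)).comp
      (P.coord : P.PhaseSpace →L[ℂ] H × H × H × H)))

/-- The map `U ↦ u - α v`. -/
noncomputable def multiplier : P.PhaseSpace →L[ℂ] H :=
  (P.negPow (1 / 2)).comp
    (((ContinuousLinearMap.fst ℂ H (H × H)).comp (ContinuousLinearMap.snd ℂ H (H × H × H))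
      - (2 * P.α : ℂ) • ContinuousLinearMap.fst ℂ H (H × H × H)).comp
        (P.coord : P.PhaseSpace →L[ℂ] H × H × H × H))

theorem momentum_apply (U : P.PhaseSpace) : P.momentum U = (P.coordLinearEquiv U).2.2.1 := rfl

theorem multiplier_apply (U : P.PhaseSpace) : P.multiplier U = P.negPow (1 / 2)
    ((P.coordLinearEquiv U).2.1 - (2 * P.α : ℂ) • (P.coordLinearEquiv U).1) := rfl

/-- The derivative of `Re ⟨v + α w, u - α v⟩` along solutions, for `s = A^{1/2} (u - α v)`. With
`u + c v` in place of `u - α v` the coefficient of `‖v + α w‖²` would be `c / α`, so `c` has to be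
negative. -/
theorem cross_term_identity (φ : ℝ) (F : P.PhaseSpace) {y p z θ s τ : H}
    (hU : P.coordLinearEquiv (P.evolutionInverse φ F) = (y, p, z, θ))
    (hs : p - (2 * P.α : ℂ) • y = s) (hτ : P.temperatureGradient φ F = τ) :
    (inner ℂ (P.momentum (P.evolutionInverse φ F)) (P.multiplier F) : ℂ).re
        + (inner ℂ (P.momentum F) (P.multiplier (P.evolutionInverse φ F)) : ℂ).re
      = -P.a ^ 2 * ‖s‖ ^ 2 - ‖z‖ ^ 2 + 2 * (inner ℂ z (P.negPow (1 / 2) y) : ℂ).re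
        + (inner ℂ ((P.η : ℂ) • P.negPow (1 - φ) τ
          - ((P.a ^ 2 * (P.β + P.α) : ℝ) : ℂ) • y) s : ℂ).re := by
  obtain ⟨y', p', z', θ', hF⟩ : ∃ y' p' z' θ',
    P.coordLinearEquiv F = (y', p', z', θ') := ⟨_, _, _, _, rfl⟩
  obtain ⟨hy', hz, hθ, hTz', hTθ'⟩ := P.coord_relations φ F hU hF hτ
  have h1 : P.multiplier F = (2 : ℂ) • P.negPow (1 / 2) y - z := by
    rw [multiplier_apply, hF, mul_smul, hy', hz, ← map_smul, ← map_sub]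
    congr 1
    module
  have h2 : (inner ℂ z' (P.negPow (1 / 2) s) : ℂ).re = -P.a ^ 2 * ‖s‖ ^ 2
      + (inner ℂ ((P.η : ℂ) • P.negPow (1 - φ) τ
          - ((P.a ^ 2 * (P.β + P.α) : ℝ) : ℂ) • y) s : ℂ).re := by
    have e : P.negPow (1 / 2) z' = ((P.η : ℂ) • P.negPow (1 - φ) τ
        - ((P.a ^ 2 * (P.β + P.α) : ℝ) : ℂ) • y) - ((P.a ^ 2 : ℝ) : ℂ) • s := by
      rw [hTz', ← hs]
      push_cast
      module
    rw [← P.inner_negPow_left, e, inner_sub_left _ _ s, inner_smul_left s, Complex.sub_re,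
      Complex.conj_ofReal, Complex.re_ofReal_mul, ← norm_sq_eq_re_inner_self]
    ring
  have h3 : (inner ℂ z ((2 : ℂ) • P.negPow (1 / 2) y - z) : ℂ).re
      = 2 * (inner ℂ z (P.negPow (1 / 2) y) : ℂ).re - ‖z‖ ^ 2 := by
    rw [inner_sub_right, inner_smul_right, Complex.sub_re, ← norm_sq_eq_re_inner_self]
    simp
  rw [h1, multiplier_apply, momentum_apply, momentum_apply, hU, hF]
  dsimp only
  rw [hs, h2, h3]
  ring

/-- The derivative of the cross term controls the energy up to the dissipation. -/
theorem exists_cross_term_le (φ : ℝ) : ∃ κ > 0, ∃ C ≥ 0, ∀ F : P.PhaseSpace,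
    (inner ℂ (P.momentum (P.evolutionInverse φ F)) (P.multiplier F) : ℂ).re
        + (inner ℂ (P.momentum F) (P.multiplier (P.evolutionInverse φ F)) : ℂ).re
      ≤ -κ * ‖P.evolutionInverse φ F‖ ^ 2 + C *
        (P.a ^ 2 * (P.β - P.α) * ‖(P.coordLinearEquiv (P.evolutionInverse φ F)).1‖ ^ 2
          + ‖P.temperatureGradient φ F‖ ^ 2) := by
  have ha := P.a_sq_pos
  have hc := sub_pos.2 P.α_lt_β
  have hα := P.α_pos
  have hac : 0 < P.a ^ 2 * (P.β - P.α) := mul_pos ha hc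
  -- total coefficients of `‖A^{1/2} v‖²` and `‖A^{1/2} θ‖²` in the error terms, for `κ = 1 / 4`
  obtain ⟨Cy, hCy⟩ : ∃ Cy, Cy = P.a ^ 2 * P.α * (P.β - P.α) / 4 + 2 * P.a ^ 2 * P.α ^ 2
    + 2 * ‖P.negPow (1 / 2)‖ ^ 2 + (P.a ^ 2 * (P.β + P.α)) ^ 2 / P.a ^ 2 := ⟨_, rfl⟩
  obtain ⟨Cτ, hCτ⟩ : ∃ Cτ, Cτ = ‖P.negPow (1 / 2)‖ ^ 2 / 4
    + (P.η * ‖P.negPow (1 - φ)‖) ^ 2 / P.a ^ 2 := ⟨_, rfl⟩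
  have hCy0 : 0 ≤ Cy := by rw [hCy]; positivity
  have hCτ0 : 0 ≤ Cτ := by rw [hCτ]; positivity
  refine ⟨1 / 4, by norm_num, Cy / (P.a ^ 2 * (P.β - P.α)) + Cτ, by positivity, fun F => ?_⟩
  obtain ⟨y, p, z, θ, hU⟩ : ∃ y p z θ,
    P.coordLinearEquiv (P.evolutionInverse φ F) = (y, p, z, θ) := ⟨_, _, _, _, rfl⟩
  obtain ⟨τ, hτ⟩ : ∃ τ, P.temperatureGradient φ F = τ := ⟨_, rfl⟩
  obtain ⟨s, hs⟩ : ∃ s, p - (2 * P.α : ℂ) • y = s := ⟨_, rfl⟩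
  obtain ⟨y', p', z', θ', hF⟩ : ∃ y' p' z' θ',
    P.coordLinearEquiv F = (y', p', z', θ') := ⟨_, _, _, _, rfl⟩
  have hθ : θ = P.negPow (1 / 2) τ := (P.coord_relations φ F hU hF hτ).2.2.1
  rw [P.cross_term_identity φ F hU hs hτ, P.norm_sq_eq_coord, hU, hτ]
  dsimp only
  have k1 : ‖θ‖ ^ 2 ≤ ‖P.negPow (1 / 2)‖ ^ 2 * ‖τ‖ ^ 2 := by
    rw [hθ, ← mul_pow]
    exact pow_le_pow_left₀ (norm_nonneg _) ((P.negPow (1 / 2)).le_opNorm τ) 2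
  have k2 : P.a ^ 2 * ‖p‖ ^ 2 ≤ P.a ^ 2 * (2 * (‖s‖ ^ 2 + 4 * P.α ^ 2 * ‖y‖ ^ 2)) := by
    refine mul_le_mul_of_nonneg_left ?_ ha.le
    have n : ‖(2 * P.α : ℂ) • y‖ ^ 2 = 4 * P.α ^ 2 * ‖y‖ ^ 2 := by
      rw [norm_smul, mul_pow]
      simp [mul_pow]
      norm_num
    have e : p = s - -((2 * P.α : ℂ) • y) := by rw [← hs]; abel
    rw [e, ← n, ← norm_neg ((2 * P.α : ℂ) • y)]
    exact norm_sub_sq_le s _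
  have k3 : 2 * (inner ℂ z (P.negPow (1 / 2) y) : ℂ).re
      ≤ ‖z‖ ^ 2 / 2 + 2 * (‖P.negPow (1 / 2)‖ ^ 2 * ‖y‖ ^ 2) := by
    have h := re_inner_le_young z (P.negPow (1 / 2) y) two_pos
    have h' := pow_le_pow_left₀ (norm_nonneg _) ((P.negPow (1 / 2)).le_opNorm y) 2
    rw [mul_pow] at h'
    linarith
  have k4 : (inner ℂ ((P.η : ℂ) • P.negPow (1 - φ) τ
      - ((P.a ^ 2 * (P.β + P.α) : ℝ) : ℂ) • y) s : ℂ).re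
      ≤ P.a ^ 2 / 2 * ‖s‖ ^ 2 + ((P.η * ‖P.negPow (1 - φ)‖) ^ 2 * ‖τ‖ ^ 2
        + (P.a ^ 2 * (P.β + P.α)) ^ 2 * ‖y‖ ^ 2) / P.a ^ 2 := by
    have h1 := re_inner_le_young ((P.η : ℂ) • P.negPow (1 - φ) τ
      - ((P.a ^ 2 * (P.β + P.α) : ℝ) : ℂ) • y) s ha
    have h2 := norm_sub_sq_le ((P.η : ℂ) • P.negPow (1 - φ) τ)
      (((P.a ^ 2 * (P.β + P.α) : ℝ) : ℂ) • y)
    have h3 : ‖(P.η : ℂ) • P.negPow (1 - φ) τ‖ ^ 2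
        ≤ (P.η * ‖P.negPow (1 - φ)‖) ^ 2 * ‖τ‖ ^ 2 := by
      rw [norm_smul, mul_pow, mul_pow, Complex.norm_real, Real.norm_eq_abs, sq_abs, mul_assoc,
        ← mul_pow ‖P.negPow (1 - φ)‖]
      exact mul_le_mul_of_nonneg_left (pow_le_pow_left₀ (norm_nonneg _)
        ((P.negPow (1 - φ)).le_opNorm τ) 2) (sq_nonneg _)
    have h4 : ‖((P.a ^ 2 * (P.β + P.α) : ℝ) : ℂ) • y‖ ^ 2
        = (P.a ^ 2 * (P.β + P.α)) ^ 2 * ‖y‖ ^ 2 := by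
      rw [norm_smul, mul_pow, Complex.norm_real, Real.norm_eq_abs, sq_abs]
    rw [h4] at h2
    refine h1.trans (add_le_add_right ?_ _)
    rw [div_le_div_iff₀ (by positivity) ha]
    have h5 := mul_le_mul_of_nonneg_right h2 ha.le
    have h6 := mul_le_mul_of_nonneg_right h3 ha.le
    linarith
  have k5 : Cy * ‖y‖ ^ 2 + Cτ * ‖τ‖ ^ 2 ≤ (Cy / (P.a ^ 2 * (P.β - P.α)) + Cτ)
      * (P.a ^ 2 * (P.β - P.α) * ‖y‖ ^ 2 + ‖τ‖ ^ 2) := by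
    generalize P.a ^ 2 * (P.β - P.α) = d at hac
    have e : (Cy / d + Cτ) * (d * ‖y‖ ^ 2 + ‖τ‖ ^ 2) = Cy * ‖y‖ ^ 2 + Cτ * ‖τ‖ ^ 2
        + (Cy / d * ‖τ‖ ^ 2 + Cτ * (d * ‖y‖ ^ 2)) := by
      field_simp
      ring
    have : 0 ≤ Cy / d * ‖τ‖ ^ 2 + Cτ * (d * ‖y‖ ^ 2) := by positivity
    linarith
  have k6 : Cy * ‖y‖ ^ 2 + Cτ * ‖τ‖ ^ 2 = P.a ^ 2 * P.α * (P.β - P.α) / 4 * ‖y‖ ^ 2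
      + 2 * P.a ^ 2 * P.α ^ 2 * ‖y‖ ^ 2 + 2 * (‖P.negPow (1 / 2)‖ ^ 2 * ‖y‖ ^ 2)
      + ‖P.negPow (1 / 2)‖ ^ 2 * ‖τ‖ ^ 2 / 4 + ((P.η * ‖P.negPow (1 - φ)‖) ^ 2 * ‖τ‖ ^ 2
        + (P.a ^ 2 * (P.β + P.α)) ^ 2 * ‖y‖ ^ 2) / P.a ^ 2 := by
    rw [hCy, hCτ]
    ring
  linarith [sq_nonneg ‖z‖]

end MGTFourier

theorem theorem7 {H : Type*} [NormedAddCommGroup H] [InnerProductSpace ℂ H] [CompleteSpace H]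
    (P : MGTFourier H) (φ : ℝ) (hφ : φ ∈ Set.Icc (0 : ℝ) 1) :
    (∃ S : ℝ → P.PhaseSpace →L[ℂ] P.PhaseSpace,
      IsC0Semigroup S ∧ IsGenerator (P.evolution φ) S) ∧
    ∀ S : ℝ → P.PhaseSpace →L[ℂ] P.PhaseSpace,
      IsC0Semigroup S → IsGenerator (P.evolution φ) S → ExponentiallyStable S := by
  have hβα := sub_pos.2 P.α_lt_β
  have ha := P.a_sq_pos
  have hdiss : IsDissipative (P.evolutionInverse φ) := fun F => by
    rw [P.re_inner_evolutionInverse φ F]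
    exact neg_nonpos.2 (by positivity)
  have hinj := P.evolutionInverse_injective φ
  constructor
  · obtain ⟨S, hS, hgen⟩ := hdiss.exists_isC0Semigroup hinj
    exact ⟨S, hS, fun x y => (P.mem_evolution_graph_iff φ x y).trans (hgen x y)⟩
  · intro S hS hgen
    obtain ⟨κ, hκ, C, hC, hcross⟩ := P.exists_cross_term_le φ
    exact exponentiallyStable_of_cross_term (hdiss.denseRange hinj) hS
      (fun x y => (P.mem_evolution_graph_iff φ x y).symm.trans (hgen x y))
      P.momentum P.multiplier (fun F => by positivity)
      (fun F => (P.re_inner_evolutionInverse φ F).le) hκ hC hcross
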